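/- **Theorem 3.1.** Let $M$ be a three-dimensional Lie group with a left invariant Riemannian metric $\langle\cdot,\cdot\rangle$, Levi-Civita connection $\nabla$ and Lie algebra $\mathfrak m$. Let $E_1(q),E_2(q),E_3(q)$ be a left invariant orthonormal frame, with Christoffel symbols $\Gamma_{ij}^k\in\mathbb R$ given by $\nabla_{E_i(q)}E_j(q)=\sum_k\Gamma_{ij}^kE_k(q)$. Vectors of $\mathfrak m$ are written $(w_1,w_2,w_3)$ with respect to $E_i=E_i(e)$, and $\times$ is the standard cross product in these coordinates. Let $\Sigma$ be a simply connected Riemann surface, and let $N^e=(N_1,N_2,N_3):\Sigma\to\mathbb S^2\subseteq\mathfrak m$ and $K:\Sigma\to(0,\infty)$ be smooth. Let $a_1\,dz,\ a_2\,dz,\ a_3\,dz$ be smooth (in the real sense) differential forms of type $(1,0)$ on $\Sigma$. Suppose that in every local conformal parameter $z$ of $\Sigma$ the following three conditions hold. 1. (Linear system) $$(a_1,a_2,a_3)=\frac{i}{\sqrt K}\,(N_1,N_2,N_3)\times(w_1,w_2,w_3),\qquad w_k=(N_k)_z+\sum_{i,j}a_iN_j\Gamma_{ij}^k .$$ 2.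 (Integrability condition) $N^e$ is parallel to $\mathfrak{Re}(V)$, that is, $\mathfrak{Re}(V)$ is a real multiple of $N^e$ at each point, where $V=(v_1,v_2,v_3)$ and $$v_k=\Big(\frac1{\sqrt K}\,u_k\Big)_{z}+\frac1{\sqrt K}\sum_{l,m}u_m\,a_l\,\Gamma_{lm}^k,\qquad u_k=(N_k)_{\bar z}+\sum_{i,j}\overline{a_i}\,N_j\,\Gamma_{ij}^k .$$ 3. (Non-degeneracy and orientation) $\det\big(N^e,\ \mathfrak{Im}(a),\ \mathfrak{Re}(a)\big)>0$ at each point, where $a=(a_1,a_2,a_3)$. Then there exists a smooth immersion $\varphi:\Sigma\to M$ such that * $N^e$ is the Gauss map of $\varphi$: the field $N=\sum_iN_iE_i(\varphi)$ is the unit normal field for which the second fundamental form $II=\langle-\nabla N,d\varphi\rangle$ is positive definite; * $K$ is the extrinsic curvature of $\varphi$, i.e. the determinant of its shape operator; * the conformal structure of $\Sigma$ is that of $II$, i.e. $II=2\rho\,|dz|^2$ with $\rho>0$ in every local conformal parameter; * $\varphi_z=a_1E_1(\varphi)+a_2E_2(\varphi)+a_3E_3(\varphi)$ in every local conformal parameter.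 This immersion is unique up to left translations: a map $\psi:\Sigma\to M$ is an immersion with all these properties if and only if $\psi=m\,\varphi$ for some $m\in M$. -/

import Mathlib

open Bundle
open scoped Manifold ContDiff Matrix

noncomputable section RiemannianLieGroupSurfaces

/-! ### Calculus on plane domains -/

/-- The Wirtinger derivative `∂f/∂z = (f_x - i f_y) / 2`. -/
def wirtinger (f : ℂ → ℂ) (w : ℂ) : ℂ :=
  (fderiv ℝ f w 1 - Complex.I * fderiv ℝ f w Complex.I) / 2

/-- The Wirtinger derivative `∂f/∂z̄ = (f_x + i f_y) / 2`. -/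
def wirtingerBar (f : ℂ → ℂ) (w : ℂ) : ℂ :=
  (fderiv ℝ f w 1 + Complex.I * fderiv ℝ f w Complex.I) / 2

/-! ### Riemannian Lie groups of dimension three -/

section LieGroup

variable {M : Type*} [TopologicalSpace M] [ChartedSpace (EuclideanSpace ℝ (Fin 3)) M] [Group M]

/-- The left invariant vector field `E_i(q) = q E_i` determined by the vector `E_i` of the Lie
algebra. -/
abbrev leftField (E : Fin 3 → GroupLieAlgebra (𝓡 3) M) (i : Fin 3) (q : M) :
    TangentSpace (𝓡 3) q :=
  mulInvariantVectorField (I := 𝓡 3) (E i) q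

variable [RiemannianBundle (fun x : M ↦ TangentSpace (𝓡 3) x)]

variable (M) in
/-- The Riemannian metric is left invariant: all left translations are isometries. -/
def IsLeftInvariantMetric : Prop :=
  ∀ (m q : M) (v w : TangentSpace (𝓡 3) q),
    inner ℝ (mfderiv (𝓡 3) (𝓡 3) (fun x ↦ m * x) q v) (mfderiv (𝓡 3) (𝓡 3) (fun x ↦ m * x) q w) =
      inner ℝ v w

/-- The left invariant vector fields `E_1(q), E_2(q), E_3(q)` form an orthonormal frame. -/
def IsOrthonormalFrame (E : Fin 3 → GroupLieAlgebra (𝓡 3) M) : Prop :=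
  ∀ (q : M) (i j : Fin 3),
    inner ℝ (leftField E i q) (leftField E j q) = if i = j then (1 : ℝ) else 0

/-- A smooth Riemannian metric is in particular of class `C¹`. -/
instance instIsContMDiffRiemannianBundleOne [IsManifold (𝓡 3) ∞ M]
    [h : IsContMDiffRiemannianBundle (𝓡 3) ∞ (EuclideanSpace ℝ (Fin 3))
      (fun x : M ↦ TangentSpace (𝓡 3) x)] :
    IsContMDiffRiemannianBundle (𝓡 3) 1 (EuclideanSpace ℝ (Fin 3))
      (fun x : M ↦ TangentSpace (𝓡 3) x) :=
  IsContMDiffRiemannianBundle.of_le (h := h) (by simp)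

/-- `cov` is the Levi-Civita connection of the Riemannian metric: it is torsion free and compatible
with the metric. -/
structure IsLeviCivita [IsManifold (𝓡 3) 2 M]
    [IsContMDiffRiemannianBundle (𝓡 3) 1 (EuclideanSpace ℝ (Fin 3))
      (fun x : M ↦ TangentSpace (𝓡 3) x)]
    (cov : CovariantDerivative (𝓡 3) (EuclideanSpace ℝ (Fin 3))
      (fun x : M ↦ TangentSpace (𝓡 3) x)) : Prop where
  torsion_eq_zero : cov.torsion = 0
  metric : cov.IsMetricCompatible

/-- The Christoffel symbols `Γ_{ij}^k = ⟨∇_{E_i} E_j, E_k⟩` of a left invariant orthonormal frame.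
For the Levi-Civita connection of a left invariant metric the right-hand side is constant on the
group, so it is evaluated at the identity. -/
def christoffel [IsManifold (𝓡 3) 1 M]
    (cov : CovariantDerivative (𝓡 3) (EuclideanSpace ℝ (Fin 3))
      (fun x : M ↦ TangentSpace (𝓡 3) x))
    (E : Fin 3 → GroupLieAlgebra (𝓡 3) M) (i j k : Fin 3) : ℝ :=
  inner ℝ (cov (leftField E j) 1 (leftField E i 1)) (leftField E k 1)

end LieGroup

/-! ### Riemann surfaces

A Riemann surface is a complex manifold `S` modelled on `ℂ`. Its local conformal parameters are the
elements `e` of the holomorphic maximal atlas, and `e.symm` parametrizes a piece of the surface by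
the open subset `e.target` of `ℂ`. The underlying smooth surface is `S` with the model
`𝓘(ℝ, ℂ)`. -/

section Surface

variable {S : Type*} [TopologicalSpace S] [ChartedSpace ℂ S]

variable (S) in
/-- The local conformal parameters of a Riemann surface. -/
abbrev conformalCharts : Set (OpenPartialHomeomorph S ℂ) :=
  IsManifold.maximalAtlas 𝓘(ℂ) ω S

/-- The tangent vector `u₁ ∂_x + u₂ ∂_y` of the surface at the point with coordinate `w`, where
`u = u₁ + i u₂` and `z = x + i y` is the local conformal parameter `e`. -/
def coordVec (e : OpenPartialHomeomorph S ℂ) (w u : ℂ) : TangentSpace 𝓘(ℝ, ℂ) (e.symm w) :=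
  mfderiv 𝓘(ℝ, ℂ) 𝓘(ℝ, ℂ) e.symm w u

/-- Three differential forms of type `(1,0)` on `S`. Each is written `a_i dz` in a local conformal
parameter `z`. -/
abbrev FormTriple (S : Type*) [TopologicalSpace S] [ChartedSpace ℂ S] : Type _ :=
  Fin 3 → ∀ p : S, TangentSpace 𝓘(ℂ) p →L[ℂ] ℂ

/-- The coefficient functions `(a_1, a_2, a_3)` of a triple of `(1,0)`-forms in a local conformal
parameter, that is, the values of the forms on `∂_z`. -/
def FormTriple.coeff (a : FormTriple S) (e : OpenPartialHomeomorph S ℂ) (w : ℂ) : Fin 3 → ℂ :=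
  fun i ↦ a i (e.symm w) (mfderiv 𝓘(ℂ) 𝓘(ℂ) e.symm w (1 : ℂ))

/-- The coefficients are smooth (in the real sense) in each local conformal parameter. -/
def FormTriple.IsSmooth (a : FormTriple S) : Prop :=
  ∀ e ∈ conformalCharts S, ∀ i, ContDiffOn ℝ ∞ (fun w ↦ a.coeff e w i) e.target

/-- The vector `((N_k)_z + ∑_{i,j} a_i N_j Γ_{ij}^k)_k`. -/
def covZ (Γ : Fin 3 → Fin 3 → Fin 3 → ℝ) (N : S → Fin 3 → ℝ) (a : FormTriple S)
    (e : OpenPartialHomeomorph S ℂ) (w : ℂ) : Fin 3 → ℂ :=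
  fun k ↦ wirtinger (fun x ↦ (N (e.symm x) k : ℂ)) w +
    ∑ i, ∑ j, a.coeff e w i * (N (e.symm w) j : ℂ) * (Γ i j k : ℂ)

/-- The vector `((N_k)_z̄ + ∑_{i,j} ā_i N_j Γ_{ij}^k)_k`. -/
def covZBar (Γ : Fin 3 → Fin 3 → Fin 3 → ℝ) (N : S → Fin 3 → ℝ) (a : FormTriple S)
    (e : OpenPartialHomeomorph S ℂ) (w : ℂ) : Fin 3 → ℂ :=
  fun k ↦ wirtingerBar (fun x ↦ (N (e.symm x) k : ℂ)) w +
    ∑ i, ∑ j, (starRingEnd ℂ) (a.coeff e w i) * (N (e.symm w) j : ℂ) * (Γ i j k : ℂ)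

/-- The linear system
`(a_1, a_2, a_3) = (i / √K) (N_1, N_2, N_3) × ((N_k)_z + ∑_{i,j} a_i N_j Γ_{ij}^k)_k`
in every local conformal parameter. -/
def SolvesLinearSystem (Γ : Fin 3 → Fin 3 → Fin 3 → ℝ) (N : S → Fin 3 → ℝ) (K : S → ℝ)
    (a : FormTriple S) : Prop :=
  ∀ e ∈ conformalCharts S, ∀ w ∈ e.target,
    a.coeff e w = (Complex.I / (Real.sqrt (K (e.symm w)) : ℂ)) •
      ((fun k ↦ (N (e.symm w) k : ℂ)) ⨯₃ covZ Γ N a e w)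

/-- The vector `V = (v_1, v_2, v_3)` with
`v_k = ((1/√K) U_k)_z + (1/√K) ∑_{l,m} U_m a_l Γ_{lm}^k`, where
`U_k = (N_k)_z̄ + ∑_{i,j} ā_i N_j Γ_{ij}^k`. -/
def integrabilityVector (Γ : Fin 3 → Fin 3 → Fin 3 → ℝ) (N : S → Fin 3 → ℝ) (K : S → ℝ)
    (a : FormTriple S) (e : OpenPartialHomeomorph S ℂ) (w : ℂ) : Fin 3 → ℂ :=
  fun k ↦
    wirtinger (fun x ↦ 1 / (Real.sqrt (K (e.symm x)) : ℂ) * covZBar Γ N a e x k) w +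
    1 / (Real.sqrt (K (e.symm w)) : ℂ) *
      ∑ l, ∑ m, covZBar Γ N a e w m * a.coeff e w l * (Γ l m k : ℂ)

/-- The integrability condition: in every local conformal parameter the (unit) vector `N` is
parallel to the real part of `V`. -/
def IntegrabilityCondition (Γ : Fin 3 → Fin 3 → Fin 3 → ℝ) (N : S → Fin 3 → ℝ) (K : S → ℝ)
    (a : FormTriple S) : Prop :=
  ∀ e ∈ conformalCharts S, ∀ w ∈ e.target, ∃ c : ℝ, ∀ k,
    (integrabilityVector Γ N K a e w k).re = c * N (e.symm w) k

/-- In every local conformal parameter `det (N, Im a, Re a) > 0`. With `φ⁻¹ φ_z = a` one has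
`φ⁻¹ φ_x = 2 Re a` and `φ⁻¹ φ_y = - 2 Im a`, so this says that `(φ_x, φ_y, N)` is a positively
oriented basis. -/
def IsPositivelyOriented (N : S → Fin 3 → ℝ) (a : FormTriple S) : Prop :=
  ∀ e ∈ conformalCharts S, ∀ w ∈ e.target,
    0 < N (e.symm w) ⬝ᵥ ((fun k ↦ (a.coeff e w k).im) ⨯₃ (fun k ↦ (a.coeff e w k).re))

end Surface

/-! ### Surfaces in Riemannian Lie groups -/

section SurfacesInGroups

variable {M : Type*} [TopologicalSpace M] [ChartedSpace (EuclideanSpace ℝ (Fin 3)) M]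
  {S : Type*} [TopologicalSpace S] [ChartedSpace ℂ S]

/-- A smooth map of the surface with injective differential at each point. -/
structure IsSmoothImmersion (φ : S → M) : Prop where
  contMDiff : ContMDiff 𝓘(ℝ, ℂ) (𝓡 3) ∞ φ
  injective_mfderiv : ∀ p, Function.Injective (mfderiv 𝓘(ℝ, ℂ) (𝓡 3) φ p)

variable [Group M]

/-- The vector field `N_1 E_1(φ) + N_2 E_2(φ) + N_3 E_3(φ)` along `φ`, whose left translation to the
identity is `(N_1, N_2, N_3)`. -/
def fieldAlong (E : Fin 3 → GroupLieAlgebra (𝓡 3) M) (φ : S → M) (N : S → Fin 3 → ℝ) (p : S) :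
    TangentSpace (𝓡 3) (φ p) :=
  ∑ j, N p j • leftField E j (φ p)

variable [RiemannianBundle (fun x : M ↦ TangentSpace (𝓡 3) x)]

/-- The components `⟨φ_z, E_i(φ)⟩` of `φ⁻¹ φ_z`, where `φ_z = (φ_x - i φ_y) / 2` in the local
conformal parameter `e`. -/
def phiZ (E : Fin 3 → GroupLieAlgebra (𝓡 3) M) (φ : S → M) (e : OpenPartialHomeomorph S ℂ)
    (w : ℂ) : Fin 3 → ℂ :=
  fun i ↦
    ((inner ℝ (mfderiv 𝓘(ℝ, ℂ) (𝓡 3) φ (e.symm w) (coordVec e w 1))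
        (leftField E i (φ (e.symm w))) : ℝ) -
      Complex.I * (inner ℝ (mfderiv 𝓘(ℝ, ℂ) (𝓡 3) φ (e.symm w) (coordVec e w Complex.I))
        (leftField E i (φ (e.symm w))) : ℝ)) / 2

/-- The equation `φ_z = a_1 E_1(φ) + a_2 E_2(φ) + a_3 E_3(φ)` in every local conformal parameter
(for an orthonormal left invariant frame). -/
def HasDerivativeForm (E : Fin 3 → GroupLieAlgebra (𝓡 3) M) (a : FormTriple S) (φ : S → M) :
    Prop :=
  ∀ e ∈ conformalCharts S, ∀ w ∈ e.target, phiZ E φ e w = a.coeff e w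

variable [IsManifold (𝓡 3) 1 M]
  (cov : CovariantDerivative (𝓡 3) (EuclideanSpace ℝ (Fin 3))
    (fun x : M ↦ TangentSpace (𝓡 3) x))
  (E : Fin 3 → GroupLieAlgebra (𝓡 3) M) (φ : S → M) (N : S → Fin 3 → ℝ)

/-- The covariant derivative along `φ` of the vector field `∑_j N_j E_j(φ)` in the direction `v`:
`∑_j (dN_j(v) E_j(φ) + N_j ∇_{dφ(v)} E_j)`. -/
def covAlong (p : S) (v : TangentSpace 𝓘(ℝ, ℂ) p) : TangentSpace (𝓡 3) (φ p) :=
  ∑ j, ((show ℝ from mfderiv 𝓘(ℝ, ℂ) 𝓘(ℝ, ℝ) (fun q ↦ N q j) p v) • leftField E j (φ p) +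
    N p j • cov (leftField E j) (φ p) (mfderiv 𝓘(ℝ, ℂ) (𝓡 3) φ p v))

/-- The second fundamental form `II(v, w) = ⟨-∇_v N, dφ(w)⟩` with respect to the normal field given
by `N`. -/
def secondForm (p : S) (v w : TangentSpace 𝓘(ℝ, ℂ) p) : ℝ :=
  inner ℝ (-covAlong cov E φ N p v) (mfderiv 𝓘(ℝ, ℂ) (𝓡 3) φ p w)

/-- `N` is the Gauss map of `φ`: it is the left translation to the identity of the unit normal field
for which the second fundamental form is positive definite. -/
structure IsGaussMap : Prop where
  unit : ∀ p, inner ℝ (fieldAlong E φ N p) (fieldAlong E φ N p) = (1 : ℝ)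
  normal : ∀ p (v : TangentSpace 𝓘(ℝ, ℂ) p),
    inner ℝ (fieldAlong E φ N p) (mfderiv 𝓘(ℝ, ℂ) (𝓡 3) φ p v) = (0 : ℝ)
  secondForm_pos : ∀ p (v : TangentSpace 𝓘(ℝ, ℂ) p), v ≠ 0 → 0 < secondForm cov E φ N p v v

/-- `K` is the extrinsic curvature of the immersion `φ`: the determinant of the shape operator `A`,
which is given by `dφ(A v) = -∇_v N`. -/
def HasExtrinsicCurvature (K : S → ℝ) : Prop :=
  ∀ p, ∃ A : TangentSpace 𝓘(ℝ, ℂ) p →ₗ[ℝ] TangentSpace 𝓘(ℝ, ℂ) p,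
    (∀ v, mfderiv 𝓘(ℝ, ℂ) (𝓡 3) φ p (A v) = -covAlong cov E φ N p v) ∧ LinearMap.det A = K p

/-- The conformal structure of `S` is that of the second fundamental form: in every local conformal
parameter `z` one has `II = 2 ρ |dz|²` with a positive function `ρ`. -/
def IsConformalSecondForm : Prop :=
  ∀ e ∈ conformalCharts S, ∀ w ∈ e.target, ∃ ρ : ℝ, 0 < ρ ∧ ∀ u v : ℂ,
    secondForm cov E φ N (e.symm w) (coordVec e w u) (coordVec e w v) =
      2 * ρ * (u * (starRingEnd ℂ) v).re

/-- `φ` is an immersion with Gauss map `N` and extrinsic curvature `K`, the conformal structure of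
`S` is that of the second fundamental form, and `φ_z = ∑ a_i E_i(φ)`. -/
structure IsPrescribedImmersion (K : S → ℝ) (a : FormTriple S) : Prop where
  immersion : IsSmoothImmersion φ
  gaussMap : IsGaussMap cov E φ N
  curvature : HasExtrinsicCurvature cov E φ N K
  conformal : IsConformalSecondForm cov E φ N
  derivative : HasDerivativeForm E a φ

end SurfacesInGroups

end RiemannianLieGroupSurfaces

/-! Everything reduces to one equation for the left logarithmic derivative, `φ⁻¹ dφ = 2 Re (a dz)`
(`HasLeftDerivAt`). It has local solutions once the Maurer–Cartan equation `Im Q = 0` holds, where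
`Q = ∇_z ā` is the covariant derivative of the conjugate form.

Write `W = ∇_z N` (`covZ`). Since `N` is a unit field, `N · W = 0`; the linear system then gives `N
· a = 0` and inverts to `W = i √K N × a`. Conjugating, `U / √K = -i N × ā`, and Leibniz gives `V =
-i (W × ā + N × Q)`. The first summand contributes a real multiple of `N`, so the integrability
condition makes `N × Im Q` parallel to `N`, hence zero. Differentiating `N · ā = 0` gives `N · Q =
-W · ā`, which is real. Thus `Im Q` vanishes (`im_covariant_conj_eq_zero`).

In a chart of the group this is the integrability of a total differential equation, solved by a
Frobenius theorem (`exists_eventually_hasFDerivAt_of_integrable`, `exists_local_solution`). Two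
solutions differ by a locally constant left factor (`eventually_mul_inv_eq`), so simple connectivity
glues local solutions into a global one, unique up to left translation. Finally `W = i √K N × a` and
the orientation condition give the normal, the second fundamental form and the curvature by algebra
in three-space (`isPrescribedImmersion_of_hasLeftDerivAt`). -/

/-! ### The Frobenius theorem via integration along rays and Grönwall estimates. -/

section TotalDifferentialEquations

open Set Metric Filter
open scoped Topology NNReal

variable {V W : Type*} [NormedAddCommGroup V] [NormedSpace ℝ V] [NormedAddCommGroup W]
  [NormedSpace ℝ W]

/-- A function whose derivative is Lipschitz on a closed ball satisfies a quadratic Taylor estimate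
there. -/
theorem norm_sub_sub_fderiv_le {F : V → W} {p₀ : V} {a : ℝ} {L : ℝ≥0}
    (hd : ∀ p ∈ closedBall p₀ a, DifferentiableAt ℝ F p)
    (hL : LipschitzOnWith L (fderiv ℝ F) (closedBall p₀ a)) {p q : V} (hp : p ∈ closedBall p₀ a)
    (hq : q ∈ closedBall p₀ a) :
    ‖F q - F p - fderiv ℝ F p (q - p)‖ ≤ L * ‖q - p‖ ^ 2 := by
  have hs : segment ℝ p q ⊆ closedBall p₀ a := (convex_closedBall p₀ a).segment_subset hp hq
  have := (convex_segment (𝕜 := ℝ) p q).norm_image_sub_le_of_norm_hasFDerivWithin_le'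
    (f := F) (f' := fderiv ℝ F) (φ := fderiv ℝ F p) (C := L * ‖q - p‖)
    (fun z hz ↦ (hd z (hs hz)).hasFDerivAt.hasFDerivWithinAt)
    (fun z hz ↦ ?_) (left_mem_segment ℝ p q) (right_mem_segment ℝ p q)
  · rwa [mul_assoc, ← sq] at this
  · refine (hL.norm_sub_le (hs hz) hp).trans ?_
    gcongr
    exact norm_sub_le_of_mem_segment hz

/-- On a small ball a `C²` function is bounded, Lipschitz, has bounded derivative and satisfies a
quadratic Taylor estimate. -/
theorem ContDiffAt.exists_taylor_bounds {F : V → W} {p₀ : V} (hF : ContDiffAt ℝ 2 F p₀) :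
    ∃ C : ℝ≥0, ∀ᶠ a in 𝓝[>] (0 : ℝ), ∀ p ∈ closedBall p₀ a, DifferentiableAt ℝ F p ∧ ‖F p‖ ≤ C ∧
      ‖fderiv ℝ F p‖ ≤ C ∧ ∀ q ∈ closedBall p₀ a, ‖F q - F p‖ ≤ C * ‖q - p‖ ∧
        ‖F q - F p - fderiv ℝ F p (q - p)‖ ≤ C * ‖q - p‖ ^ 2 := by
  obtain ⟨L₁, s₁, hs₁, hL₁⟩ := (hF.of_le one_le_two).exists_lipschitzOnWith
  have hF' : ContDiffAt ℝ 1 (fderiv ℝ F) p₀ := hF.fderiv_right (by norm_num)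
  obtain ⟨L₂, s₂, hs₂, hL₂⟩ := hF'.exists_lipschitzOnWith
  have hd : ∀ᶠ p in 𝓝 p₀, DifferentiableAt ℝ F p :=
    (hF.eventually (by simp)).mono fun p hp ↦ hp.differentiableAt (by simp)
  have hb₁ : ∀ᶠ p in 𝓝 p₀, ‖F p‖ < ‖F p₀‖ + 1 :=
    hF.continuousAt.norm.eventually_lt continuousAt_const (by simp)
  have hb₂ : ∀ᶠ p in 𝓝 p₀, ‖fderiv ℝ F p‖ < ‖fderiv ℝ F p₀‖ + 1 :=
    hF'.continuousAt.norm.eventually_lt continuousAt_const (by simp)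
  refine ⟨L₁ + L₂ + (‖F p₀‖₊ + 1) + (‖fderiv ℝ F p₀‖₊ + 1), ?_⟩
  obtain ⟨ε, hε, hball⟩ := Metric.mem_nhds_iff.1
    (inter_mem (inter_mem hs₁ hs₂) (hd.and (hb₁.and hb₂)))
  filter_upwards [Ioo_mem_nhdsGT hε] with a ha p hp
  have hsub : closedBall p₀ a ⊆ ball p₀ ε := closedBall_subset_ball ha.2
  obtain ⟨-, hpd, hp₁, hp₂⟩ := hball (hsub hp)
  have h₁ : (0 : ℝ) ≤ L₁ := L₁.2
  have h₂ : (0 : ℝ) ≤ L₂ := L₂.2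
  have h₃ := norm_nonneg (F p₀)
  have h₄ := norm_nonneg (fderiv ℝ F p₀)
  push_cast
  refine ⟨hpd, by linarith, by linarith, fun q hq ↦ ⟨?_, ?_⟩⟩
  · refine (hL₁.norm_sub_le (hball (hsub hq)).1.1 (hball (hsub hp)).1.1).trans ?_
    gcongr
    linarith
  · refine (norm_sub_sub_fderiv_le (fun z hz ↦ (hball (hsub hz)).2.1)
      (hL₂.mono fun z hz ↦ (hball (hsub hz)).1.2) hp hq).trans ?_
    gcongr
    linarith

/-- A solution of the integral equation of the Picard–Lindelöf theorem stays in the ball. -/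
theorem IsPicardLindelof.exists_forall_mem_closedBall [CompleteSpace W] {f : ℝ → W → W}
    {tmin tmax : ℝ} {t₀ : Icc tmin tmax} {w₀ : W} {a L K : ℝ≥0}
    (hf : IsPicardLindelof f t₀ w₀ a 0 L K) :
    ∃ α : ℝ → W, α t₀ = w₀ ∧ (∀ t, α t ∈ closedBall w₀ a) ∧
      ∀ t ∈ Icc tmin tmax, HasDerivWithinAt α (f t (α t)) (Icc tmin tmax) t := by
  have hx : w₀ ∈ closedBall w₀ ((0 : ℝ≥0) : ℝ) := mem_closedBall_self le_rfl
  obtain ⟨α, hα⟩ := ODE.FunSpace.exists_isFixedPt_next hf hx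
  refine ⟨α.compProj, by rw [ODE.FunSpace.compProj_val, ← hα, ODE.FunSpace.next_apply₀],
    fun t ↦ α.compProj_mem_closedBall hf.mul_max_le, fun t ht ↦ ?_⟩
  apply ODE.hasDerivWithinAt_picard_Icc t₀.2 hf.continuousOn_uncurry
    α.continuous_compProj.continuousOn (fun _ ht' ↦ α.compProj_mem_closedBall hf.mul_max_le)
    w₀ ht |>.congr_of_mem _ ht
  intro t' ht'
  nth_rw 1 [← hα]
  rw [ODE.FunSpace.compProj_of_mem ht', ODE.FunSpace.next_apply]

theorem gronwallBound_zero_left (K ε x : ℝ) :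
    gronwallBound 0 K ε x = ε * gronwallBound 0 K 1 x := by
  unfold gronwallBound
  split_ifs <;> ring

theorem gronwallBound_zero_one_nonneg {K : ℝ} (hK : 0 ≤ K) {x : ℝ} (hx : 0 ≤ x) :
    0 ≤ gronwallBound 0 K 1 x := by
  simpa [gronwallBound_x0] using gronwallBound_mono le_rfl zero_le_one hK hx

/-- **Grönwall** on the unit interval for a function that vanishes at the origin. -/
theorem norm_le_mul_of_norm_deriv_le {f f' : ℝ → W} {K ε : ℝ} (hK : 0 ≤ K) (hε : 0 ≤ ε)
    (hf : ∀ t ∈ Icc (0 : ℝ) 1, HasDerivWithinAt f (f' t) (Icc 0 1) t) (h₀ : f 0 = 0)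
    (bound : ∀ t ∈ Icc (0 : ℝ) 1, ‖f' t‖ ≤ K * ‖f t‖ + ε) {t : ℝ} (ht : t ∈ Icc (0 : ℝ) 1) :
    ‖f t‖ ≤ gronwallBound 0 K 1 1 * ε := by
  have h := norm_le_gronwallBound_of_norm_deriv_right_le (δ := 0) (K := K) (ε := ε)
    (fun s hs ↦ (hf s hs).continuousWithinAt)
    (fun s hs ↦ (hf s (Ico_subset_Icc_self hs)).mono_of_mem_nhdsWithin
      (Icc_mem_nhdsGE_of_mem hs)) (by simp [h₀])
    (fun s hs ↦ bound s (Ico_subset_Icc_self hs)) t ht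
  rw [sub_zero] at h
  refine (h.trans (gronwallBound_mono le_rfl hε hK ht.2)).trans_eq ?_
  rw [gronwallBound_zero_left, mul_comm]

/-- The **Frobenius theorem** for a total differential equation `du = F(x, u)`. -/
theorem exists_eventually_hasFDerivAt_of_integrable [CompleteSpace W] {F : V × W → V →L[ℝ] W}
    {x₀ : V} {w₀ : W} (hF : ContDiffAt ℝ 2 F (x₀, w₀))
    (hint : ∀ᶠ p in 𝓝 (x₀, w₀), ∀ h k,
      fderiv ℝ F p (h, F p h) k = fderiv ℝ F p (k, F p k) h) :
    ∃ u : V → W, u x₀ = w₀ ∧ ∀ᶠ x in 𝓝 x₀, HasFDerivAt u (F (x, u x)) x := by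
  obtain ⟨C, hC⟩ := hF.exists_taylor_bounds
  obtain ⟨ε, hε, hball⟩ := Metric.mem_nhds_iff.1 hint
  obtain ⟨a, ha, haC, haε⟩ : ∃ a : ℝ, 0 < a ∧ _ ∧ a < ε :=
    ((eventually_mem_nhdsWithin.and (hC.and (nhdsWithin_le_nhds (gt_mem_nhds hε))))).exists
  replace hint : ∀ p ∈ closedBall (x₀, w₀) a, ∀ h k,
      fderiv ℝ F p (h, F p h) k = fderiv ℝ F p (k, F p k) h := fun p hp ↦
    hball (closedBall_subset_ball haε hp)
  -- The velocity along a ray is at most `C * r`, so `C * r ≤ a` keeps the solution in the ball of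
  -- radius `a` up to time 1.
  obtain ⟨r, hr, hra, hCr⟩ : ∃ r : ℝ, 0 < r ∧ r ≤ a ∧ C * r ≤ a := by
    refine ⟨a / (C + 1), by positivity, div_le_self ha.le (by simp), ?_⟩
    rw [mul_div_assoc', div_le_iff₀ (by positivity)]
    nlinarith [C.2]
  have hmem {y : V} (hy : ‖y‖ ≤ r) {t : ℝ} (ht : t ∈ Icc (0 : ℝ) 1) {w : W}
      (hw : w ∈ closedBall w₀ a) : (x₀ + t • y, w) ∈ closedBall (x₀, w₀) a := by
    rw [← closedBall_prod_same]
    refine ⟨?_, hw⟩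
    rw [mem_closedBall_iff_norm, add_sub_cancel_left, norm_smul, Real.norm_of_nonneg ht.1]
    nlinarith [ht.2, norm_nonneg y]
  have hpl (y : V) (hy : ‖y‖ ≤ r) : ∃ γ : ℝ → W, γ 0 = w₀ ∧ (∀ t, γ t ∈ closedBall w₀ a) ∧
      ∀ t ∈ Icc (0 : ℝ) 1, HasDerivWithinAt γ (F (x₀ + t • y, γ t) y) (Icc 0 1) t := by
    have key : IsPicardLindelof (fun t w ↦ F (x₀ + t • y, w) y)
        (⟨0, by simp⟩ : Icc (0 : ℝ) 1) w₀ ⟨a, ha.le⟩ 0 (C * ⟨r, hr.le⟩) (C * ⟨r, hr.le⟩) := by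
      refine ⟨fun t ht ↦ LipschitzOnWith.of_dist_le_mul fun w hw w' hw' ↦ ?_, fun w hw t ht ↦ ?_,
        fun t ht w hw ↦ ?_, ?_⟩
      · rw [dist_eq_norm, dist_eq_norm, ← sub_apply]
        refine (ContinuousLinearMap.le_opNorm _ _).trans ?_
        have := ((haC _ (hmem hy ht hw')).2.2.2 _ (hmem hy ht hw)).1
        simp only [Prod.mk_sub_mk, sub_self, Prod.norm_mk, norm_zero] at this
        rw [max_eq_right (norm_nonneg _)] at this
        change _ ≤ (C * r : ℝ) * _
        nlinarith [norm_nonneg y, norm_nonneg (w - w'), C.2, mul_nonneg C.2 (norm_nonneg (w - w')),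
          mul_le_mul this hy (norm_nonneg y) (by positivity)]
      · have := (haC _ (hmem hy ht hw)).1.continuousAt
        have h2 : ContinuousAt (fun t : ℝ ↦ (x₀ + t • y, w)) t := by fun_prop
        exact ((this.comp (f := fun t : ℝ ↦ (x₀ + t • y, w)) h2).clm_apply
          continuousAt_const).continuousWithinAt
      · refine (ContinuousLinearMap.le_opNorm _ _).trans ?_
        change _ ≤ (C * r : ℝ)
        exact mul_le_mul (haC _ (hmem hy ht hw)).2.1 hy (norm_nonneg y) C.2
      · change (C * r : ℝ) * max (1 - 0) (0 - 0) ≤ a - 0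
        simpa using hCr
    exact key.exists_forall_mem_closedBall
  choose! γ hγ₀ hγmem hγ using hpl
  -- The candidate solution is the time-one value along the ray from `x₀` to `x`. Along the zero ray
  -- the velocity vanishes, so its value at `x₀` is `w₀`.
  refine ⟨fun x ↦ γ (x - x₀) 1, ?_, ?_⟩
  · have h0 : ∀ t ∈ Icc (0 : ℝ) 1, ‖γ 0 t - w₀‖ ≤ gronwallBound 0 0 1 1 * 0 := fun t ht ↦
      norm_le_mul_of_norm_deriv_le le_rfl le_rfl (f := fun t ↦ γ 0 t - w₀) (f' := fun _ ↦ 0)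
        (fun s hs ↦ by simpa using (hγ 0 (by simpa using hr.le) s hs).sub_const w₀)
        (by simp [hγ₀ 0 (by simpa using hr.le)]) (by simp) ht
    simpa [sub_eq_zero] using h0 1 (by simp)
  set G := gronwallBound 0 (C * r) 1 1 with hG
  have hG0 : 0 ≤ G := gronwallBound_zero_one_nonneg (by positivity) zero_le_one
  have hlip {y y' : V} (hy : ‖y‖ ≤ r) (hy' : ‖y'‖ ≤ r) {t : ℝ} (ht : t ∈ Icc (0 : ℝ) 1) :
      ‖γ y' t - γ y t‖ ≤ G * ((C * r + C) * ‖y' - y‖) := by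
    refine norm_le_mul_of_norm_deriv_le (f := fun t ↦ γ y' t - γ y t) (by positivity)
      (by positivity) (fun s hs ↦ (hγ y' hy' s hs).sub (hγ y hy s hs))
      (by simp [hγ₀ y hy, hγ₀ y' hy']) (fun s hs ↦ ?_) ht
    have hp := hmem hy hs (hγmem y hy s)
    have hq := hmem hy' hs (hγmem y' hy' s)
    have h1 := ((haC _ hp).2.2.2 _ hq).1
    have h2 := (haC _ hp).2.1
    have h3 : ‖((x₀ + s • y', γ y' s) : V × W) - (x₀ + s • y, γ y s)‖ ≤
        ‖y' - y‖ + ‖γ y' s - γ y s‖ := by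
      rw [Prod.mk_sub_mk, Prod.norm_mk, add_sub_add_left_eq_sub, ← smul_sub, norm_smul,
        Real.norm_of_nonneg hs.1]
      refine max_le ?_ ?_ <;> nlinarith [hs.2, norm_nonneg (y' - y), norm_nonneg (γ y' s - γ y s)]
    calc ‖F (x₀ + s • y', γ y' s) y' - F (x₀ + s • y, γ y s) y‖
        = ‖(F (x₀ + s • y', γ y' s) - F (x₀ + s • y, γ y s)) y' + F (x₀ + s • y, γ y s) (y' - y)‖ := by
          simp
      _ ≤ C * (‖y' - y‖ + ‖γ y' s - γ y s‖) * r + C * ‖y' - y‖ := by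
          refine (norm_add_le _ _).trans (add_le_add ?_ ?_)
          · refine (ContinuousLinearMap.le_opNorm _ _).trans
              (mul_le_mul (h1.trans ?_) hy' (norm_nonneg _) (by positivity))
            gcongr
          · exact (ContinuousLinearMap.le_opNorm _ _).trans (by gcongr)
      _ = C * r * ‖γ y' s - γ y s‖ + (C * r + C) * ‖y' - y‖ := by ring
  -- `D` is a Lipschitz constant for `y ↦ (x₀ + s • y, γ y s)`, uniform in `s`.
  set D : ℝ := 1 + G * (C * r + C) with hD
  have hD0 : 0 ≤ D := by positivity
  have hquad {y y' : V} (hy : ‖y‖ ≤ r) (hy' : ‖y'‖ ≤ r) :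
      ‖γ y' 1 - γ y 1 - F (x₀ + y, γ y 1) (y' - y)‖ ≤
        G * ((C * D ^ 2 * r + C * D) * ‖y' - y‖ ^ 2) := by
    -- The variation of `γ y t` in direction `y' - y` should be `t • F (x₀ + t • y, γ y t) (y' -
    -- y)`. The error satisfies a linear differential inequality with quadratic inhomogeneity, so
    -- Grönwall makes it quadratic in `y' - y`.
    have := norm_le_mul_of_norm_deriv_le (K := C * r)
      (f := fun t ↦ γ y' t - γ y t - t • F (x₀ + t • y, γ y t) (y' - y))
      (f' := fun t ↦ F (x₀ + t • y', γ y' t) y' - F (x₀ + t • y, γ y t) y -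
        (t • (fderiv ℝ F (x₀ + t • y, γ y t) (y, F (x₀ + t • y, γ y t) y)) (y' - y) +
          (1 : ℝ) • F (x₀ + t • y, γ y t) (y' - y)))
      (ε := (C * D ^ 2 * r + C * D) * ‖y' - y‖ ^ 2) (t := 1) (by positivity) (by positivity)
      (fun s hs ↦ ?_) (by simp [hγ₀ y hy, hγ₀ y' hy']) (fun s hs ↦ ?_) (by simp)
    · simpa using this
    · refine ((hγ y' hy' s hs).sub (hγ y hy s hs)).sub ((hasDerivWithinAt_id s _).smul ?_)
      have h1 : HasDerivWithinAt (fun t ↦ (x₀ + t • y, γ y t)) (y, F (x₀ + s • y, γ y s) y)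
          (Icc 0 1) s := by
        refine HasDerivWithinAt.prodMk ?_ (hγ y hy s hs)
        simpa using ((hasDerivWithinAt_id s (Icc 0 1)).smul_const y).const_add x₀
      have h2 := (haC _ (hmem hy hs (hγmem y hy s))).1.hasFDerivAt.comp_hasDerivWithinAt s h1
      simpa using h2.clm_apply (hasDerivWithinAt_const s (Icc 0 1) (y' - y))
    · have hp := hmem hy hs (hγmem y hy s)
      have hq := hmem hy' hs (hγmem y' hy' s)
      set p : V × W := (x₀ + s • y, γ y s) with hpdef
      set q : V × W := (x₀ + s • y', γ y' s) with hqdef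
      obtain ⟨-, hb, hb', hTaylor⟩ := haC _ hp
      obtain ⟨h1, h2⟩ := hTaylor q hq
      have hqp : q - p = (s • (y' - y), γ y' s - γ y s) := by
        simp [p, q, smul_sub]
      have h3 : ‖q - p‖ ≤ D * ‖y' - y‖ := by
        have hl := hlip hy hy' hs
        rw [hqp, Prod.norm_mk, norm_smul, Real.norm_of_nonneg hs.1]
        have hG1 : 0 ≤ G * (C * r + C) * ‖y' - y‖ := by positivity
        refine max_le ?_ ?_
        · nlinarith [hs.2, norm_nonneg (y' - y)]
        · nlinarith [norm_nonneg (y' - y)]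
      have hrew : F q y' - F p y - (s • (fderiv ℝ F p (y, F p y)) (y' - y) +
            (1 : ℝ) • F p (y' - y)) =
          (F q - F p - fderiv ℝ F p (q - p)) y + (F q - F p) (y' - y) +
            fderiv ℝ F p (0, γ y' s - γ y s - s • F p (y' - y)) y := by
        have hz : (q - p) = s • (y' - y, F p (y' - y)) +
            (0, γ y' s - γ y s - s • F p (y' - y)) := by
          rw [hqp]; ext <;> simp
        -- Integrability swaps `y` and `y' - y`. The `t`-derivative of the expected variation
        -- thereby becomes the linear Taylor term of `F` at `p`, up to the error being estimated.
        rw [hint p hp y (y' - y), hz]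
        simp only [map_add, map_smul, sub_apply, add_apply, smul_apply, map_sub]
        module
      rw [hrew]
      have e1 : ‖(F q - F p - fderiv ℝ F p (q - p)) y‖ ≤ C * (D * ‖y' - y‖) ^ 2 * r :=
        (ContinuousLinearMap.le_opNorm _ _).trans
          (mul_le_mul (h2.trans (by gcongr)) hy (norm_nonneg _) (by positivity))
      have e2 : ‖(F q - F p) (y' - y)‖ ≤ C * (D * ‖y' - y‖) * ‖y' - y‖ :=
        (ContinuousLinearMap.le_opNorm _ _).trans
          (mul_le_mul_of_nonneg_right (h1.trans (by gcongr)) (norm_nonneg _))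
      have e3 : ‖fderiv ℝ F p (0, γ y' s - γ y s - s • F p (y' - y)) y‖ ≤
          C * ‖γ y' s - γ y s - s • F p (y' - y)‖ * r := by
        refine (ContinuousLinearMap.le_opNorm _ _).trans
          (mul_le_mul ((ContinuousLinearMap.le_opNorm _ _).trans ?_) hy (norm_nonneg _)
            (by positivity))
        rw [Prod.norm_mk, norm_zero, max_eq_right (norm_nonneg _)]
        gcongr
      refine (norm_add₃_le).trans ((add_le_add_three e1 e2 e3).trans_eq ?_)
      ring
  filter_upwards [ball_mem_nhds x₀ hr] with x hx
  have hxr : ‖x - x₀‖ ≤ r := (mem_ball_iff_norm.1 hx).le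
  rw [hasFDerivAt_iff_isLittleO]
  refine Asymptotics.IsBigO.trans_isLittleO (g := fun z ↦ ‖z - x‖ ^ 2) ?_ ?_
  · refine Asymptotics.IsBigO.of_bound (G * (C * D ^ 2 * r + C * D)) ?_
    filter_upwards [isOpen_ball.mem_nhds hx] with z hz
    have := hquad hxr (mem_ball_iff_norm.1 hz).le
    simp only [add_sub_cancel, sub_sub_sub_cancel_right] at this
    refine this.trans_eq ?_
    rw [norm_pow, norm_norm, ← mul_assoc]
  · have h0 : Tendsto (fun z ↦ ‖z - x‖) (𝓝 x) (𝓝 0) := by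
      have : Continuous fun z ↦ ‖z - x‖ := by fun_prop
      simpa using this.tendsto x
    simp_rw [sq]
    have := ((Asymptotics.isLittleO_one_iff ℝ).2 h0).mul_isBigO
      (Asymptotics.isBigO_refl (fun z ↦ ‖z - x‖) (𝓝 x))
    simpa using this

end TotalDifferentialEquations

/-! ### Gluing by monodromy on a simply connected space. -/

section Gluing

open Set Filter
open scoped Topology

/-- A family of local functions with values in a group, any two of which differ by a locally constant
left factor, on a simply connected space: there is a global function that differs from each of them
by a locally constant left factor. -/
theorem SimplyConnectedSpace.exists_eventually_mul_inv_eq {X G : Type*} [TopologicalSpace X]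
    [SimplyConnectedSpace X] [LocallyPathConnectedSpace X] [Group G] (U : X → Set X)
    (hU : ∀ i, IsOpen (U i)) (hmem : ∀ i, i ∈ U i) (f : X → X → G)
    (hf : ∀ i j, ∀ x ∈ U i ∩ U j, ∀ᶠ y in 𝓝 x, f i y * (f j y)⁻¹ = f i x * (f j x)⁻¹) :
    ∃ g : X → G, ∀ i, ∀ x ∈ U i, ∀ᶠ y in 𝓝 x, g y * (f i y)⁻¹ = g x * (f i x)⁻¹ := by
  -- With the discrete topology on the fibre, locally constant transition functions are continuous
  -- and the bundle is a covering space.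
  let _ : TopologicalSpace G := ⊥
  have : DiscreteTopology G := ⟨rfl⟩
  let Z : FiberBundleCore X X G :=
    { baseSet := U
      isOpen_baseSet := hU
      indexAt := id
      mem_baseSet_at := hmem
      coordChange := fun i j x v ↦ v * (f i x * (f j x)⁻¹)
      coordChange_self := fun i x _ v ↦ by simp
      continuousOn_coordChange := fun i j ↦ by
        refine continuousOn_snd.mul (fun p hp ↦ ContinuousAt.continuousWithinAt ?_)
        have h : (fun q : X × G ↦ f i q.1 * (f j q.1)⁻¹) =ᶠ[𝓝 p]
            fun _ ↦ f i p.1 * (f j p.1)⁻¹ :=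
          continuous_fst.continuousAt.eventually (hf i j p.1 hp.1)
        exact (continuousAt_const (y := f i p.1 * (f j p.1)⁻¹)).congr h.symm
      coordChange_comp := fun i j k x _ v ↦ by group }
  have cov : IsCoveringMap (π G Z.Fiber) := FiberBundle.isCoveringMap
  obtain ⟨x₀⟩ : Nonempty X := inferInstance
  -- A lift of the identity map is a global section; it exists because the base is simply connected.
  obtain ⟨F, ⟨-, hF⟩, -⟩ := cov.existsUnique_continuousMap_lifts (ContinuousMap.id X) x₀
    (⟨x₀, (1 : G)⟩ : TotalSpace G Z.Fiber) rfl
  have hF' (x : X) : (F x).1 = x := congrFun hF x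
  refine ⟨fun x ↦ (show G from (F x).2) * f x x, fun i x hx ↦ ?_⟩
  -- Read in the trivialization `i`, the section is the quotient of the global function by `f i`. It
  -- is continuous into a discrete space, hence locally constant.
  have hval (y : X) : (Z.localTriv i (F y)).2 = (show G from (F y).2) * f y y * (f i y)⁻¹ := by
    rw [Z.localTriv_apply]
    change (show G from (F y).2) * (f (F y).1 (F y).1 * (f i (F y).1)⁻¹) = _
    rw [hF' y, mul_assoc]
  have hcont : ContinuousAt (fun y ↦ (Z.localTriv i (F y)).2) x := by
    refine continuousAt_snd.comp (ContinuousAt.comp (g := Z.localTriv i) ?_ F.continuous.continuousAt)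
    refine (Z.localTriv i).continuousOn.continuousAt ((Z.localTriv i).open_source.mem_nhds ?_)
    rw [Z.mem_localTriv_source]
    change (F x).1 ∈ U i
    rwa [hF' x]
  have := hcont.eventually (IsOpen.mem_nhds (isOpen_discrete {(Z.localTriv i (F x)).2}) rfl)
  filter_upwards [this] with y hy
  rw [← hval, ← hval]
  exact hy

end Gluing

/-! ### Wirtinger derivatives of real and conjugate functions. -/

section WirtingerCalculus

open Filter
open scoped Topology ComplexConjugate

theorem wirtinger_congr {f g : ℂ → ℂ} {w : ℂ} (h : f =ᶠ[𝓝 w] g) :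
    wirtinger f w = wirtinger g w := by
  simp only [wirtinger, h.fderiv_eq]

theorem wirtinger_mul {f g : ℂ → ℂ} {w : ℂ} (hf : DifferentiableAt ℝ f w)
    (hg : DifferentiableAt ℝ g w) :
    wirtinger (fun x ↦ f x * g x) w = wirtinger f w * g w + f w * wirtinger g w := by
  simp only [wirtinger, fderiv_fun_mul hf hg, add_apply, smul_apply, smul_eq_mul]
  ring

theorem wirtinger_const_mul {f : ℂ → ℂ} {w : ℂ} (hf : DifferentiableAt ℝ f w) (c : ℂ) :
    wirtinger (fun x ↦ c * f x) w = c * wirtinger f w := by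
  simp only [wirtinger, fderiv_const_mul hf, smul_apply, smul_eq_mul]
  ring

theorem wirtinger_add {f g : ℂ → ℂ} {w : ℂ} (hf : DifferentiableAt ℝ f w)
    (hg : DifferentiableAt ℝ g w) :
    wirtinger (fun x ↦ f x + g x) w = wirtinger f w + wirtinger g w := by
  simp only [wirtinger, fderiv_fun_add hf hg, add_apply]
  ring

theorem wirtinger_sub {f g : ℂ → ℂ} {w : ℂ} (hf : DifferentiableAt ℝ f w)
    (hg : DifferentiableAt ℝ g w) :
    wirtinger (fun x ↦ f x - g x) w = wirtinger f w - wirtinger g w := by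
  simp only [wirtinger, fderiv_fun_sub hf hg, sub_apply]
  ring

theorem wirtinger_const (c w : ℂ) : wirtinger (fun _ ↦ c) w = 0 := by
  simp [wirtinger]

theorem fderiv_ofReal_comp {f : ℂ → ℝ} {w : ℂ} (hf : DifferentiableAt ℝ f w) (u : ℂ) :
    fderiv ℝ (fun x ↦ (f x : ℂ)) w u = (fderiv ℝ f w u : ℝ) := by
  have := (Complex.ofRealCLM.hasFDerivAt.comp w hf.hasFDerivAt).fderiv
  exact congrArg (fun T ↦ T u) this

theorem wirtingerBar_ofReal {f : ℂ → ℝ} {w : ℂ} (hf : DifferentiableAt ℝ f w) :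
    wirtingerBar (fun x ↦ (f x : ℂ)) w = conj (wirtinger (fun x ↦ (f x : ℂ)) w) := by
  simp [wirtinger, wirtingerBar, fderiv_ofReal_comp hf, map_ofNat]

/-- The derivative of a real function in terms of its Wirtinger derivative. -/
theorem fderiv_eq_re_wirtinger {f : ℂ → ℝ} {w : ℂ} (hf : DifferentiableAt ℝ f w) (u : ℂ) :
    fderiv ℝ f w u = 2 * (wirtinger (fun x ↦ (f x : ℂ)) w * u).re := by
  have hu : u = u.re • (1 : ℂ) + u.im • Complex.I := by
    simp [Complex.re_add_im]
  conv_lhs => rw [hu, map_add, map_smul, map_smul]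
  simp [wirtinger, fderiv_ofReal_comp hf]
  ring

/-- The right-hand side is half the coefficient of `dx ∧ dy` in the exterior derivative of `Re (f
dz)`. This links the complex covariant derivative to the real structure equation. -/
theorem im_wirtinger_conj {f : ℂ → ℂ} {w : ℂ} (hf : DifferentiableAt ℝ f w) :
    (wirtinger (fun x ↦ conj (f x)) w).im =
      -((fderiv ℝ f w 1).im + (fderiv ℝ f w Complex.I).re) / 2 := by
  have h : ∀ u, fderiv ℝ (fun x ↦ conj (f x)) w u = conj (fderiv ℝ f w u) := fun u ↦
    congrArg (fun T ↦ T u) (Complex.conjCLE.toContinuousLinearMap.hasFDerivAt.comp w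
      hf.hasFDerivAt).fderiv
  simp [wirtinger, h]
  ring

end WirtingerCalculus

/-! ### From the integrability condition to the Maurer–Cartan equation. -/

section MaurerCartan

open Filter
open scoped Topology ComplexConjugate

/-- For symbols `Γ_{ij}^k` that are skew in `j, k`, the endomorphism `∑_l α_l Γ_{lm}^k` is the cross
product with this vector. -/
def connectionVector (Γ : Fin 3 → Fin 3 → Fin 3 → ℝ) (α : Fin 3 → ℂ) : Fin 3 → ℂ :=
  ![∑ l, α l * Γ l 1 2, ∑ l, α l * Γ l 2 0, ∑ l, α l * Γ l 0 1]

variable {Γ : Fin 3 → Fin 3 → Fin 3 → ℝ}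

/-- Skew endomorphisms of three-space are cross products. Connection terms therefore obey the Jacobi
identity and cancel against the vectors they rotate. -/
theorem sum_mul_christoffel_eq_cross (hΓ : ∀ i j k, Γ i j k = -Γ i k j) (α X : Fin 3 → ℂ)
    (k : Fin 3) :
    ∑ l, ∑ m, α l * X m * (Γ l m k : ℂ) = (connectionVector Γ α ⨯₃ X) k := by
  have h0 : ∀ i j, Γ i j j = 0 := fun i j ↦ by linarith [hΓ i j j]
  have h1 : ∀ i, Γ i 1 0 = -Γ i 0 1 := fun i ↦ hΓ i 1 0
  have h2 : ∀ i, Γ i 2 1 = -Γ i 1 2 := fun i ↦ hΓ i 2 1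
  have h3 : ∀ i, Γ i 0 2 = -Γ i 2 0 := fun i ↦ hΓ i 0 2
  fin_cases k <;>
  · simp [Fin.sum_univ_three, connectionVector, cross_apply, h0, h1, h2, h3]
    ring

/-- On the plane orthogonal to `n` the map `n ×` squares to `-1`, so the linear system can be
inverted there. -/
theorem cross_triple_of_unit {n W A : Fin 3 → ℂ} {s : ℂ} (hs : s ≠ 0) (hn : n ⬝ᵥ n = 1)
    (hW : n ⬝ᵥ W = 0) (hA : A = (Complex.I / s) • (n ⨯₃ W)) :
    n ⬝ᵥ A = 0 ∧ W = (Complex.I * s) • (n ⨯₃ A) := by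
  refine ⟨by rw [hA, dotProduct_smul, dot_self_cross, smul_zero], ?_⟩
  rw [hA, map_smul, cross_cross_eq_smul_sub_smul', hn, hW, smul_smul]
  have : Complex.I * s * (Complex.I / s) = -1 := by
    field_simp; exact Complex.I_sq
  rw [this]
  simp

theorem dotProduct_wirtinger_eq_neg {f g : ℂ → Fin 3 → ℂ} {w c : ℂ}
    (hf : ∀ k, DifferentiableAt ℝ (fun x ↦ f x k) w)
    (hg : ∀ k, DifferentiableAt ℝ (fun x ↦ g x k) w) (h : ∀ᶠ x in 𝓝 w, f x ⬝ᵥ g x = c) :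
    (fun k ↦ wirtinger (fun x ↦ f x k) w) ⬝ᵥ g w +
      f w ⬝ᵥ (fun k ↦ wirtinger (fun x ↦ g x k) w) = 0 := by
  have h1 : wirtinger (fun x ↦ f x ⬝ᵥ g x) w = 0 := by
    rw [wirtinger_congr (g := fun _ ↦ c) h, wirtinger_const]
  rw [← h1]
  simp only [dotProduct, Fin.sum_univ_three]
  rw [wirtinger_add (((hf 0).fun_mul (hg 0)).fun_add ((hf 1).fun_mul (hg 1))) ((hf 2).fun_mul (hg 2)),
    wirtinger_add ((hf 0).fun_mul (hg 0)) ((hf 1).fun_mul (hg 1)), wirtinger_mul (hf 0) (hg 0),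
    wirtinger_mul (hf 1) (hg 1), wirtinger_mul (hf 2) (hg 2)]
  ring

theorem wirtinger_cross {f g : ℂ → Fin 3 → ℂ} {w : ℂ}
    (hf : ∀ k, DifferentiableAt ℝ (fun x ↦ f x k) w)
    (hg : ∀ k, DifferentiableAt ℝ (fun x ↦ g x k) w) (k : Fin 3) :
    wirtinger (fun x ↦ (f x ⨯₃ g x) k) w =
      ((fun k ↦ wirtinger (fun x ↦ f x k) w) ⨯₃ g w +
        f w ⨯₃ (fun k ↦ wirtinger (fun x ↦ g x k) w)) k := by
  have key (i j : Fin 3) : wirtinger (fun x ↦ f x i * g x j - f x j * g x i) w =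
      wirtinger (fun x ↦ f x i) w * g w j - wirtinger (fun x ↦ f x j) w * g w i +
        (f w i * wirtinger (fun x ↦ g x j) w - f w j * wirtinger (fun x ↦ g x i) w) := by
    rw [wirtinger_sub ((hf i).fun_mul (hg j)) ((hf j).fun_mul (hg i)), wirtinger_mul (hf i) (hg j),
      wirtinger_mul (hf j) (hg i)]
    ring
  fin_cases k <;> simp [cross_apply, key]

theorem conj_cross (v w : Fin 3 → ℂ) :
    (fun k ↦ conj ((v ⨯₃ w) k)) = (fun k ↦ conj (v k)) ⨯₃ (fun k ↦ conj (w k)) := by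
  ext k
  fin_cases k <;> simp [cross_apply]

theorem im_ofReal_cross (n : Fin 3 → ℝ) (Q : Fin 3 → ℂ) :
    (fun k ↦ (((fun k ↦ (n k : ℂ)) ⨯₃ Q) k).im) = n ⨯₃ (fun k ↦ (Q k).im) := by
  ext k
  fin_cases k <;> simp [cross_apply]

theorem im_ofReal_dotProduct (n : Fin 3 → ℝ) (Q : Fin 3 → ℂ) :
    ((fun k ↦ (n k : ℂ)) ⬝ᵥ Q).im = n ⬝ᵥ (fun k ↦ (Q k).im) := by
  simp [dotProduct, Fin.sum_univ_three]

theorem ofReal_dotProduct (n m : Fin 3 → ℝ) :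
    (fun k ↦ (n k : ℂ)) ⬝ᵥ (fun k ↦ (m k : ℂ)) = ((n ⬝ᵥ m : ℝ) : ℂ) := by
  simp [dotProduct, Fin.sum_univ_three]

/-- A vector that is annihilated by the cross product and the scalar product with a unit vector
vanishes. -/
theorem eq_zero_of_cross_of_dotProduct {n X : Fin 3 → ℝ} (hn : n ⬝ᵥ n = 1) (h : n ⨯₃ X = 0)
    (h' : n ⬝ᵥ X = 0) : X = 0 := by
  have := cross_cross_eq_smul_sub_smul' n n X
  rw [h, map_zero, h', hn] at this
  simpa using this.symm

variable {n : ℂ → Fin 3 → ℝ} {κ : ℂ → ℝ} {A : ℂ → Fin 3 → ℂ} {O : Set ℂ}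

/-- The covariant derivative of the normal field is a rotation of the derivative of the surface. -/
theorem dotProduct_eq_zero_and_eq_cross (hΓ : ∀ i j k, Γ i j k = -Γ i k j) (hO : IsOpen O)
    (hn : ∀ k, DifferentiableOn ℝ (fun x ↦ n x k) O) (hunit : ∀ x ∈ O, n x ⬝ᵥ n x = 1)
    (hκ : ∀ x ∈ O, 0 < κ x) {W : ℂ → Fin 3 → ℂ}
    (hW : ∀ x ∈ O, ∀ k, W x k = wirtinger (fun y ↦ (n y k : ℂ)) x +
      ∑ i, ∑ j, A x i * (n x j : ℂ) * (Γ i j k : ℂ))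
    (hsys : ∀ x ∈ O, A x = (Complex.I / (Real.sqrt (κ x) : ℂ)) •
      ((fun k ↦ (n x k : ℂ)) ⨯₃ W x)) {w : ℂ} (hw : w ∈ O) :
    (fun k ↦ (n w k : ℂ)) ⬝ᵥ A w = 0 ∧
      W w = (Complex.I * (Real.sqrt (κ w) : ℂ)) • ((fun k ↦ (n w k : ℂ)) ⨯₃ A w) := by
  have hnd : ∀ k, DifferentiableAt ℝ (fun x ↦ (n x k : ℂ)) w := fun k ↦
    Complex.ofRealCLM.differentiableAt.comp w ((hn k).differentiableAt (hO.mem_nhds hw))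
  have hs : (Real.sqrt (κ w) : ℂ) ≠ 0 := by
    exact_mod_cast (Real.sqrt_pos.2 (hκ w hw)).ne'
  refine cross_triple_of_unit hs (by rw [ofReal_dotProduct, hunit w hw, Complex.ofReal_one]) ?_
    (hsys w hw)
  -- Differentiating `n · n = 1` shows that `n_z` is orthogonal to `n`; the connection term of `W`
  -- is a cross product with `n`, hence orthogonal too.
  have h1 := dotProduct_wirtinger_eq_neg (f := fun x k ↦ (n x k : ℂ)) (g := fun x k ↦ (n x k : ℂ))
    (c := 1) hnd hnd (by
      filter_upwards [hO.mem_nhds hw] with x hx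
      rw [ofReal_dotProduct, hunit x hx, Complex.ofReal_one])
  rw [dotProduct_comm, ← two_mul, mul_eq_zero] at h1
  have hW' : W w = (fun k ↦ wirtinger (fun y ↦ (n y k : ℂ)) w) +
      connectionVector Γ (A w) ⨯₃ (fun k ↦ (n w k : ℂ)) := by
    ext k
    rw [hW w hw, sum_mul_christoffel_eq_cross hΓ, Pi.add_apply]
  rw [hW', dotProduct_add, dot_cross_self, h1.resolve_left two_ne_zero, add_zero]

/-- The integrability condition on the real part of `V` implies the Maurer–Cartan equation. -/
theorem im_covariant_conj_eq_zero (hΓ : ∀ i j k, Γ i j k = -Γ i k j) (hO : IsOpen O)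
    (hn : ∀ k, DifferentiableOn ℝ (fun x ↦ n x k) O)
    (hA : ∀ k, DifferentiableOn ℝ (fun x ↦ A x k) O) (hunit : ∀ x ∈ O, n x ⬝ᵥ n x = 1)
    (hκ : ∀ x ∈ O, 0 < κ x) {W U : ℂ → Fin 3 → ℂ}
    (hW : ∀ x ∈ O, ∀ k, W x k = wirtinger (fun y ↦ (n y k : ℂ)) x +
      ∑ i, ∑ j, A x i * (n x j : ℂ) * (Γ i j k : ℂ))
    (hU : ∀ x ∈ O, ∀ k, U x k = wirtingerBar (fun y ↦ (n y k : ℂ)) x +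
      ∑ i, ∑ j, conj (A x i) * (n x j : ℂ) * (Γ i j k : ℂ))
    (hsys : ∀ x ∈ O, A x = (Complex.I / (Real.sqrt (κ x) : ℂ)) •
      ((fun k ↦ (n x k : ℂ)) ⨯₃ W x)) {w : ℂ} (hw : w ∈ O) {c : ℝ}
    (hc : ∀ k, (wirtinger (fun x ↦ 1 / (Real.sqrt (κ x) : ℂ) * U x k) w +
      1 / (Real.sqrt (κ w) : ℂ) * ∑ l, ∑ m, U w m * A w l * (Γ l m k : ℂ)).re = c * n w k)
    (k : Fin 3) :
    (wirtinger (fun x ↦ conj (A x k)) w +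
      ∑ l, ∑ m, A w l * conj (A w m) * (Γ l m k : ℂ)).im = 0 := by
  have hnd (k) : DifferentiableAt ℝ (fun x ↦ n x k) w := (hn k).differentiableAt (hO.mem_nhds hw)
  have hnd' (k) : DifferentiableAt ℝ (fun x ↦ (n x k : ℂ)) w :=
    Complex.ofRealCLM.differentiableAt.comp w (hnd k)
  have hAd (k) : DifferentiableAt ℝ (fun x ↦ conj (A x k)) w :=
    Complex.conjCLE.toContinuousLinearMap.differentiableAt.comp w
      ((hA k).differentiableAt (hO.mem_nhds hw))
  -- the vector field `U / √κ`
  have hUA : ∀ x ∈ O, (1 / (Real.sqrt (κ x) : ℂ)) • U x =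
      (-Complex.I) • ((fun k ↦ (n x k : ℂ)) ⨯₃ (fun k ↦ conj (A x k))) := by
    intro x hx
    have hs : (Real.sqrt (κ x) : ℂ) ≠ 0 := by exact_mod_cast (Real.sqrt_pos.2 (hκ x hx)).ne'
    have hUW : U x = fun k ↦ conj (W x k) := by
      ext k
      rw [hU x hx, hW x hx, wirtingerBar_ofReal ((hn k).differentiableAt (hO.mem_nhds hx))]
      simp
    have h2 : (fun k ↦ conj (W x k)) = (-Complex.I * (Real.sqrt (κ x) : ℂ)) •
        ((fun k ↦ (n x k : ℂ)) ⨯₃ (fun k ↦ conj (A x k))) := by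
      rw [(dotProduct_eq_zero_and_eq_cross hΓ hO hn hunit hκ hW hsys hx).2]
      have := conj_cross (fun k ↦ (n x k : ℂ)) (A x)
      simp only [Complex.conj_ofReal] at this
      rw [← this]
      ext k
      simp
    rw [hUW, h2, smul_smul]
    congr 1
    field_simp
  set nC : Fin 3 → ℂ := fun k ↦ (n w k : ℂ) with hnC
  set B : Fin 3 → ℂ := fun k ↦ conj (A w k) with hB
  set θ := connectionVector Γ (A w) with hθ
  set Bz : Fin 3 → ℂ := fun k ↦ wirtinger (fun x ↦ conj (A x k)) w with hBz
  set nz : Fin 3 → ℂ := fun k ↦ wirtinger (fun x ↦ (n x k : ℂ)) w with hnz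
  obtain ⟨hnA, hWA⟩ := dotProduct_eq_zero_and_eq_cross hΓ hO hn hunit hκ hW hsys hw
  have hnn : nC ⬝ᵥ nC = 1 := by rw [ofReal_dotProduct, hunit w hw, Complex.ofReal_one]
  have hWw : W w = nz + θ ⨯₃ nC := by
    ext k
    rw [hW w hw, sum_mul_christoffel_eq_cross hΓ, Pi.add_apply]
  have hnB' : ∀ x ∈ O, (fun k ↦ (n x k : ℂ)) ⬝ᵥ (fun k ↦ conj (A x k)) = 0 := by
    intro x hx
    have := congrArg conj (dotProduct_eq_zero_and_eq_cross hΓ hO hn hunit hκ hW hsys hx).1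
    simpa [dotProduct] using this
  have hnB : nC ⬝ᵥ B = 0 := hnB' w hw
  -- the covariant derivative of the conjugate form
  set Q : Fin 3 → ℂ := Bz + θ ⨯₃ B with hQ
  suffices hmain : (fun k ↦ (Q k).im) = 0 by
    have := congrFun hmain k
    rw [sum_mul_christoffel_eq_cross hΓ (A w) B k]
    simpa [hQ, hBz] using this
  -- Leibniz rule for the covariant derivative of `-i n × B`: the derivative falls on `n`, giving
  -- `W`, or on `B`, giving `Q`.
  have hV : (fun k ↦ wirtinger (fun x ↦ 1 / (Real.sqrt (κ x) : ℂ) * U x k) w +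
      1 / (Real.sqrt (κ w) : ℂ) * ∑ l, ∑ m, U w m * A w l * (Γ l m k : ℂ)) =
      (-Complex.I) • (W w ⨯₃ B + nC ⨯₃ Q) := by
    have e1 (k) : wirtinger (fun x ↦ 1 / (Real.sqrt (κ x) : ℂ) * U x k) w =
        -Complex.I * (nz ⨯₃ B + nC ⨯₃ Bz) k := by
      rw [← wirtinger_cross (f := fun x k ↦ (n x k : ℂ)) (g := fun x k ↦ conj (A x k)) hnd' hAd,
        ← wirtinger_const_mul]
      · refine wirtinger_congr ?_
        filter_upwards [hO.mem_nhds hw] with x hx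
        simpa using congrFun (hUA x hx) k
      · fin_cases k <;> simp only [cross_apply] <;>
          exact ((hnd' _).mul (hAd _)).sub ((hnd' _).mul (hAd _))
    have e2 (k) : 1 / (Real.sqrt (κ w) : ℂ) * ∑ l, ∑ m, U w m * A w l * (Γ l m k : ℂ) =
        -Complex.I * (θ ⨯₃ (nC ⨯₃ B)) k := by
      have h3 := congrArg (fun X ↦ (θ ⨯₃ X) k) (hUA w hw)
      simp only [map_smul, Pi.smul_apply, smul_eq_mul] at h3
      rw [← h3, ← sum_mul_christoffel_eq_cross hΓ]
      simp only [mul_comm (U w _)]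
    ext k
    rw [e1, e2, leibniz_cross, ← mul_add, Pi.smul_apply, smul_eq_mul, hWw, hQ, ← Pi.add_apply]
    congr 2
    rw [map_add, map_add, LinearMap.add_apply]
    simp only [Pi.add_apply]
    ring
  have hAB : (A w ⬝ᵥ B).im = 0 := by
    simp [dotProduct, hB, Fin.sum_univ_three]
    ring
  have hWB : W w ⨯₃ B = (-(Complex.I * (Real.sqrt (κ w) : ℂ)) * (A w ⬝ᵥ B)) • nC := by
    rw [hWA, map_smul, LinearMap.smul_apply, cross_cross_eq_smul_sub_smul, hnB, zero_smul, zero_sub,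
      smul_neg, smul_smul, neg_mul, neg_smul]
  -- As `A · B = |A|²` is real, `-i W × B` is a real multiple of `n`. So the real part of `V` being
  -- parallel to `n` says that `n × Im Q` is parallel to `n`, to which it is also orthogonal.
  have hcross : n w ⨯₃ (fun k ↦ (Q k).im) = (c + Real.sqrt (κ w) * (A w ⬝ᵥ B).re) • n w := by
    rw [← im_ofReal_cross]
    ext k
    have h4 := hc k
    rw [congrFun hV k, hWB] at h4
    simp [hAB, nC] at h4
    simp only [Pi.smul_apply, smul_eq_mul]
    linarith
  have hcoef : c + Real.sqrt (κ w) * (A w ⬝ᵥ B).re = 0 := by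
    have := dot_self_cross (n w) (fun k ↦ (Q k).im)
    rwa [hcross, dotProduct_smul, hunit w hw, smul_eq_mul, mul_one] at this
  refine eq_zero_of_cross_of_dotProduct (hunit w hw) (by rw [hcross, hcoef, zero_smul]) ?_
  rw [← im_ofReal_dotProduct]
  have h5 := dotProduct_wirtinger_eq_neg (f := fun x k ↦ (n x k : ℂ))
    (g := fun x k ↦ conj (A x k)) (c := 0) hnd' hAd (by
      filter_upwards [hO.mem_nhds hw] with x hx using hnB' x hx)
  change nz ⬝ᵥ B + nC ⬝ᵥ Bz = 0 at h5
  -- The covariant form of differentiating `n · B = 0`. The right-hand side is real because `(n × A)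
  -- · B` is purely imaginary and `W` carries another factor `i`.
  have h6 : nC ⬝ᵥ Q = -(W w ⬝ᵥ B) := by
    have h7 : nC ⬝ᵥ θ ⨯₃ B = -((θ ⨯₃ nC) ⬝ᵥ B) := by
      rw [triple_product_permutation, ← cross_anticomm, dotProduct_neg, dotProduct_comm (θ ⨯₃ nC),
        triple_product_permutation B]
    rw [hQ, dotProduct_add, h7, hWw, add_dotProduct]
    linear_combination h5
  change (nC ⬝ᵥ Q).im = 0
  rw [h6, hWA, smul_dotProduct]
  simp [cross_apply, dotProduct, Fin.sum_univ_three, hB]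
  right
  ring

end MaurerCartan

/-! ### Left invariant frames and constancy of their Christoffel symbols. -/

section LeftInvariantFields

variable {M : Type*} [TopologicalSpace M] [ChartedSpace (EuclideanSpace ℝ (Fin 3)) M] [Group M]
  [LieGroup (𝓡 3) ∞ M]

local instance instLieGroupMinSmoothness : LieGroup (𝓡 3) (minSmoothness ℝ 3) M :=
  LieGroup.of_le (n := ∞) (by
    rw [minSmoothness_of_isRCLikeNormedField]
    exact ENat.LEInfty.out)

/-- The field is the tangent map of multiplication applied to `(0_g, v)`, a composite of smooth
maps. -/
theorem contMDiff_infty_mulInvariantVectorField (v : GroupLieAlgebra (𝓡 3) M) :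
    ContMDiff (𝓡 3) (𝓡 3).tangent ∞
      (fun g : M ↦ (mulInvariantVectorField v g : TangentBundle (𝓡 3) M)) := by
  let fg : M → TangentBundle (𝓡 3) M := fun g ↦ TotalSpace.mk' (EuclideanSpace ℝ (Fin 3)) g 0
  have sfg : ContMDiff (𝓡 3) (𝓡 3).tangent ∞ fg := contMDiff_zeroSection _ _
  let fv : M → TangentBundle (𝓡 3) M := fun _ ↦ TotalSpace.mk' (EuclideanSpace ℝ (Fin 3)) 1 v
  have sfv : ContMDiff (𝓡 3) (𝓡 3).tangent ∞ fv := contMDiff_const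
  let F₁ : M → (TangentBundle (𝓡 3) M × TangentBundle (𝓡 3) M) := fun g ↦ (fg g, fv g)
  have S₁ : ContMDiff (𝓡 3) ((𝓡 3).tangent.prod (𝓡 3).tangent) ∞ F₁ := sfg.prodMk sfv
  let F₂ : (TangentBundle (𝓡 3) M × TangentBundle (𝓡 3) M) →
      TangentBundle ((𝓡 3).prod (𝓡 3)) (M × M) := (equivTangentBundleProd (𝓡 3) M (𝓡 3) M).symm
  have S₂ : ContMDiff ((𝓡 3).tangent.prod (𝓡 3).tangent) ((𝓡 3).prod (𝓡 3)).tangent ∞ F₂ :=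
    contMDiff_equivTangentBundleProd_symm
  let F₃ : TangentBundle ((𝓡 3).prod (𝓡 3)) (M × M) → TangentBundle (𝓡 3) M :=
    tangentMap ((𝓡 3).prod (𝓡 3)) (𝓡 3) (fun p : M × M ↦ p.1 * p.2)
  have S₃ : ContMDiff ((𝓡 3).prod (𝓡 3)).tangent (𝓡 3).tangent ∞ F₃ :=
    ContMDiff.contMDiff_tangentMap (contMDiff_mul (𝓡 3) ∞) (m := ∞) (by simp)
  let S := (S₃.comp S₂).comp S₁
  convert! S with g
  · simp [F₁, F₂, F₃, fg, fv]
  · simp only [Function.comp_apply, tangentMap, F₃, F₂, F₁, fg, fv]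
    rw [mfderiv_prod_eq_add_apply ((contMDiff_mul (𝓡 3) ∞).mdifferentiableAt (by simp))]
    have h0 : mfderiv (𝓡 3) (𝓡 3) (fun z : M ↦ z * 1) g 0 = 0 := map_zero _
    exact ((congrArg (· + _) h0).trans (zero_add _)).symm

theorem mdifferentiableAt_leftField (E : Fin 3 → GroupLieAlgebra (𝓡 3) M) (i : Fin 3) (q : M) :
    MDifferentiableAt (𝓡 3) (𝓡 3).tangent
      (fun g : M ↦ (leftField E i g : TangentBundle (𝓡 3) M)) q :=
  (contMDiff_infty_mulInvariantVectorField (E i)).mdifferentiableAt (by simp)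

theorem mdifferentiable_mul_left' (m : M) : MDifferentiable (𝓡 3) (𝓡 3) (fun x : M ↦ m * x) :=
  (contMDiff_mul_left (I := 𝓡 3) (n := ∞)).mdifferentiable (by simp)

/-- Left translations preserve the left invariant fields. -/
theorem mfderiv_mul_left_mulInvariantVectorField (v : GroupLieAlgebra (𝓡 3) M) (m q : M) :
    mfderiv (𝓡 3) (𝓡 3) (fun x ↦ m * x) q (mulInvariantVectorField v q) =
      mulInvariantVectorField v (m * q) := by
  have h : (fun x : M ↦ m * q * x) = (fun x ↦ m * x) ∘ (fun x ↦ q * x) := by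
    ext x; simp [mul_assoc]
  have h2 := mfderiv_comp_apply (I := 𝓡 3) (I' := 𝓡 3) (I'' := 𝓡 3) (1 : M) (v := v)
    (f := fun x ↦ q * x) (mdifferentiable_mul_left' m (q * 1)) (mdifferentiable_mul_left' q 1)
  -- Tangent spaces at equal base points are different types over one model space; stating the
  -- equality in the model space allows substitution of the base point.
  have h3 : ∀ q', q' = q → ∀ u : EuclideanSpace ℝ (Fin 3),
      (mfderiv (𝓡 3) (𝓡 3) (fun x ↦ m * x) q' u : EuclideanSpace ℝ (Fin 3)) =
        mfderiv (𝓡 3) (𝓡 3) (fun x ↦ m * x) q u := by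
    rintro _ rfl u
    rfl
  change _ = mfderiv (𝓡 3) (𝓡 3) (fun x : M ↦ m * q * x) 1 v
  rw [h]
  exact ((h2.trans (h3 _ (mul_one q) _))).symm

variable [RiemannianBundle (fun x : M ↦ TangentSpace (𝓡 3) x)]

theorem IsLeftInvariantMetric.inner_mulInvariantVectorField (hM : IsLeftInvariantMetric M)
    (v w : GroupLieAlgebra (𝓡 3) M) (q : M) :
    inner ℝ (mulInvariantVectorField v q) (mulInvariantVectorField w q) =
      inner ℝ (mulInvariantVectorField v (1 : M)) (mulInvariantVectorField w (1 : M)) := by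
  calc
    inner ℝ (mulInvariantVectorField v q) (mulInvariantVectorField w q)
      = inner ℝ (mulInvariantVectorField v (q * 1)) (mulInvariantVectorField w (q * 1)) := by
        rw [mul_one]
    _ = inner ℝ (mfderiv (𝓡 3) (𝓡 3) (fun x ↦ q * x) 1 (mulInvariantVectorField v 1))
          (mfderiv (𝓡 3) (𝓡 3) (fun x ↦ q * x) 1 (mulInvariantVectorField w 1)) :=
        (congrArg₂ (fun a b : TangentSpace (𝓡 3) (q * 1) ↦ inner ℝ a b)
          (mfderiv_mul_left_mulInvariantVectorField v q 1)
          (mfderiv_mul_left_mulInvariantVectorField w q 1)).symm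
    _ = _ := hM q 1 _ _

variable {E : Fin 3 → GroupLieAlgebra (𝓡 3) M}

omit [LieGroup (𝓡 3) ∞ M] in
theorem IsOrthonormalFrame.linearIndependent (hE : IsOrthonormalFrame E) (q : M) :
    LinearIndependent ℝ (fun i ↦ leftField E i q) := by
  rw [Fintype.linearIndependent_iff]
  intro g hg i
  have := congrArg (fun v ↦ inner ℝ (leftField E i q) v) hg
  simpa [inner_sum, inner_smul_right, hE q] using this

omit [LieGroup (𝓡 3) ∞ M] in
theorem IsOrthonormalFrame.eq_sum (hE : IsOrthonormalFrame E) (q : M) (v : TangentSpace (𝓡 3) q) :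
    v = ∑ k, inner ℝ v (leftField E k q) • leftField E k q := by
  have hcard : Fintype.card (Fin 3) = Module.finrank ℝ (TangentSpace (𝓡 3) q) := by
    change _ = Module.finrank ℝ (EuclideanSpace ℝ (Fin 3))
    simp
  let b := basisOfLinearIndependentOfCardEqFinrank (hE.linearIndependent q) hcard
  have hb : ∀ k, b k = leftField E k q := fun k ↦ by simp [b]
  have hv := b.sum_repr v
  simp only [hb] at hv
  have hc (k) : inner ℝ v (leftField E k q) = b.repr v k := by
    conv_lhs => rw [← hv]
    simp [sum_inner, inner_smul_left, hE q]
  simp only [hc]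
  exact hv.symm

omit [LieGroup (𝓡 3) ∞ M] in
theorem IsOrthonormalFrame.inner_sum_smul (hE : IsOrthonormalFrame E) (q : M) (c d : Fin 3 → ℝ) :
    inner ℝ (∑ k, c k • leftField E k q) (∑ k, d k • leftField E k q) = c ⬝ᵥ d := by
  simp [sum_inner, inner_sum, inner_smul_left, inner_smul_right, hE q, dotProduct, mul_comm]

omit [LieGroup (𝓡 3) ∞ M] in
theorem IsOrthonormalFrame.inner_sum_smul_left (hE : IsOrthonormalFrame E) (q : M) (c : Fin 3 → ℝ)
    (k : Fin 3) : inner ℝ (∑ k, c k • leftField E k q) (leftField E k q) = c k := by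
  simp [sum_inner, inner_smul_left, hE q]

variable [IsContMDiffRiemannianBundle (𝓡 3) ∞ (EuclideanSpace ℝ (Fin 3))
    (fun x : M ↦ TangentSpace (𝓡 3) x)]
  {cov : CovariantDerivative (𝓡 3) (EuclideanSpace ℝ (Fin 3))
    (fun x : M ↦ TangentSpace (𝓡 3) x)}

/-- The functions `⟨E_j, E_k⟩` are constant; differentiate them along `E_i` by metric compatibility.
-/
theorem IsLeviCivita.inner_skew (hcov : IsLeviCivita cov) (hE : IsOrthonormalFrame E) (q : M)
    (i j k : Fin 3) :
    inner ℝ (cov (leftField E j) q (leftField E i q)) (leftField E k q) =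
      -inner ℝ (cov (leftField E k) q (leftField E i q)) (leftField E j q) := by
  have h := hcov.metric.mvfderiv_inner_eq (leftField E i) (mdifferentiableAt_leftField E j q)
    (mdifferentiableAt_leftField E k q)
  have hconst : (fun x : M ↦ inner ℝ (leftField E j x) (leftField E k x)) =
      fun _ ↦ if j = k then (1 : ℝ) else 0 := by
    ext x
    exact hE x j k
  rw [hconst] at h
  simp only [mvfderiv_const] at h
  rw [real_inner_comm (leftField E j q), eq_neg_iff_add_eq_zero]
  exact h.symm

theorem IsLeviCivita.mlieBracket_leftField (hcov : IsLeviCivita cov) (q : M) (i j : Fin 3) :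
    VectorField.mlieBracket (𝓡 3) (leftField E i) (leftField E j) q =
      cov (leftField E j) q (leftField E i q) - cov (leftField E i) q (leftField E j q) :=
  (cov.torsion_eq_zero_iff.1 hcov.torsion_eq_zero (mdifferentiableAt_leftField E i q)
    (mdifferentiableAt_leftField E j q)).symm

/-- The Koszul argument: cyclic permutation recovers the symbols from their skewness in the last two
indices and their antisymmetrization in the first two. -/
theorem eq_of_skew_of_torsion_eq {G G' : Fin 3 → Fin 3 → Fin 3 → ℝ}
    (h : ∀ i j k, G i j k = -G i k j) (h' : ∀ i j k, G' i j k = -G' i k j)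
    (ht : ∀ i j k, G i j k - G j i k = G' i j k - G' j i k) : G = G' := by
  ext i j k
  linarith [h i j k, h k i j, h j k i, h' i j k, h' k i j, h' j k i, ht i j k, ht j k i, ht k i j]

/-- The Christoffel symbols of a left invariant frame are constant. -/
theorem IsLeviCivita.inner_cov_eq_christoffel (hM : IsLeftInvariantMetric M)
    (hcov : IsLeviCivita cov) (hE : IsOrthonormalFrame E) (q : M) (i j k : Fin 3) :
    inner ℝ (cov (leftField E j) q (leftField E i q)) (leftField E k q) =
      christoffel cov E i j k := by
  -- The symbols at `q` and at the identity have equal antisymmetrizations, because brackets of left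
  -- invariant fields are left invariant.
  have key := eq_of_skew_of_torsion_eq
    (G := fun i j k ↦ inner ℝ (cov (leftField E j) q (leftField E i q)) (leftField E k q))
    (G' := christoffel cov E) (hcov.inner_skew hE q) (hcov.inner_skew hE 1) (fun i j k ↦ ?_)
  · exact congrFun (congrFun (congrFun key i) j) k
  · simp only [christoffel]
    rw [← inner_sub_left, ← inner_sub_left, ← hcov.mlieBracket_leftField,
      ← hcov.mlieBracket_leftField, ← mulInvariantVector_mlieBracket]
    exact hM.inner_mulInvariantVectorField _ _ q

theorem IsLeviCivita.christoffel_skew (hcov : IsLeviCivita cov) (hE : IsOrthonormalFrame E)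
    (i j k : Fin 3) : christoffel cov E i j k = -christoffel cov E i k j :=
  hcov.inner_skew hE 1 i j k

theorem IsLeviCivita.cov_leftField (hM : IsLeftInvariantMetric M) (hcov : IsLeviCivita cov)
    (hE : IsOrthonormalFrame E) (q : M) (i j : Fin 3) :
    cov (leftField E j) q (leftField E i q) =
      ∑ k, christoffel cov E i j k • leftField E k q := by
  rw [hE.eq_sum q (cov (leftField E j) q (leftField E i q))]
  simp only [hcov.inner_cov_eq_christoffel hM hE]

theorem IsLeviCivita.mlieBracket_eq_sum (hM : IsLeftInvariantMetric M) (hcov : IsLeviCivita cov)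
    (hE : IsOrthonormalFrame E) (q : M) (i j : Fin 3) :
    VectorField.mlieBracket (𝓡 3) (leftField E i) (leftField E j) q =
      ∑ k, (christoffel cov E i j k - christoffel cov E j i k) • leftField E k q := by
  rw [hcov.mlieBracket_leftField, hcov.cov_leftField hM hE, hcov.cov_leftField hM hE]
  simp only [sub_smul, Finset.sum_sub_distrib]

end LeftInvariantFields

/-! ### Local solutions in a chart of the group. -/

section LocalExistence

open Filter
open scoped Topology ComplexConjugate

/-- A solution of `du = F(x, u)` with smooth right-hand side is smooth. -/
theorem contDiffOn_infty_of_hasFDerivAt {V W : Type*} [NormedAddCommGroup V] [NormedSpace ℝ V]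
    [NormedAddCommGroup W] [NormedSpace ℝ W] {F : V × W → V →L[ℝ] W} {Ω : Set (V × W)} {s : Set V}
    (hF : ContDiffOn ℝ ∞ F Ω) (hs : IsOpen s) {u : V → W} (hmem : ∀ x ∈ s, (x, u x) ∈ Ω)
    (hu : ∀ x ∈ s, HasFDerivAt u (F (x, u x)) x) : ContDiffOn ℝ ∞ u s := by
  rw [contDiffOn_infty]
  intro n
  induction n with
  | zero =>
    exact contDiffOn_zero.2 fun x hx ↦ (hu x hx).continuousAt.continuousWithinAt
  | succ n ih =>
    push_cast
    rw [contDiffOn_succ_iff_fderiv_of_isOpen hs]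
    refine ⟨fun x hx ↦ (hu x hx).differentiableAt.differentiableWithinAt, by simp, ?_⟩
    have h1 : ContDiffOn ℝ n (fun x ↦ F (x, u x)) s :=
      (contDiffOn_infty.1 hF n).comp (contDiffOn_id.prodMk ih) hmem
    exact h1.congr fun x hx ↦ (hu x hx).fderiv

/-- The real bilinear form `2 Re(a h)`. -/
noncomputable def rePairing : ℂ →L[ℝ] ℂ →L[ℝ] ℝ :=
  (2 : ℝ) • (ContinuousLinearMap.compL ℝ ℂ ℂ ℝ Complex.reCLM).comp (ContinuousLinearMap.mul ℝ ℂ)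

theorem rePairing_apply (a h : ℂ) : rePairing a h = 2 * (a * h).re := by
  simp [rePairing]

/-- The structure equation of the real forms `2 Re(A_l dz)`, from the vanishing of the imaginary part
of the covariant derivative. -/
theorem rePairing_structure_equation {Γ : Fin 3 → Fin 3 → Fin 3 → ℝ} {A : ℂ → Fin 3 → ℂ} {w : ℂ}
    (hA : ∀ i, DifferentiableAt ℝ (fun x ↦ A x i) w) {l : Fin 3}
    (hMC : (wirtinger (fun x ↦ conj (A x l)) w +
      ∑ i, ∑ j, A w i * conj (A w j) * (Γ i j l : ℂ)).im = 0) (h k : ℂ) :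
    rePairing (fderiv ℝ (fun x ↦ A x l) w h) k - rePairing (fderiv ℝ (fun x ↦ A x l) w k) h +
      ∑ i, ∑ j, rePairing (A w i) k * rePairing (A w j) h * (Γ j i l - Γ i j l) = 0 := by
  have hexp (h : ℂ) : fderiv ℝ (fun x ↦ A x l) w h =
      h.re • fderiv ℝ (fun x ↦ A x l) w 1 + h.im • fderiv ℝ (fun x ↦ A x l) w Complex.I := by
    rw [← map_smul, ← map_smul, ← map_add]
    congr 1
    simp [Complex.re_add_im]
  rw [Complex.add_im, im_wirtinger_conj (hA l)] at hMC
  rw [hexp h, hexp k]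
  simp only [rePairing_apply, Fin.sum_univ_three, Complex.add_im, Complex.mul_im, Complex.mul_re,
    Complex.add_re, Complex.conj_re, Complex.conj_im, Complex.ofReal_re, Complex.ofReal_im,
    Complex.real_smul] at hMC ⊢
  -- Both sides are alternating in `h, k`, so only the coefficient of `dx ∧ dy` matters. The 4
  -- combines the 2 in `rePairing` with the one half in the Wirtinger derivative.
  linear_combination 4 * (h.re * k.im - h.im * k.re) * hMC

variable {M : Type*} [TopologicalSpace M] [ChartedSpace (EuclideanSpace ℝ (Fin 3)) M] [Group M]
  [LieGroup (𝓡 3) ∞ M]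

attribute [local instance] instLieGroupMinSmoothness

variable (M) in
/-- The chart of the group at the identity. -/
abbrev chartOne : OpenPartialHomeomorph M (EuclideanSpace ℝ (Fin 3)) :=
  chartAt (EuclideanSpace ℝ (Fin 3)) (1 : M)

/-- A left invariant field in the chart at the identity. -/
noncomputable def fieldInChart (v : GroupLieAlgebra (𝓡 3) M) :
    EuclideanSpace ℝ (Fin 3) → EuclideanSpace ℝ (Fin 3) :=
  VectorField.mpullback (𝓡 3) (𝓡 3) (chartOne M).symm (mulInvariantVectorField v)

theorem contMDiffAt_chartOne_symm {u : EuclideanSpace ℝ (Fin 3)} (hu : u ∈ (chartOne M).target) :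
    ContMDiffAt (𝓡 3) (𝓡 3) ∞ (chartOne M).symm u :=
  contMDiffAt_symm_of_mem_maximalAtlas (IsManifold.chart_mem_maximalAtlas _) hu

theorem isInvertible_mfderiv_chartOne_symm {u : EuclideanSpace ℝ (Fin 3)}
    (hu : u ∈ (chartOne M).target) :
    (mfderiv (𝓡 3) (𝓡 3) (chartOne M).symm u).IsInvertible :=
  ⟨(mdifferentiable_chart (I := 𝓡 3) (1 : M)).symm.mfderiv hu, rfl⟩

theorem mfderiv_chartOne_symm_fieldInChart (v : GroupLieAlgebra (𝓡 3) M)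
    {u : EuclideanSpace ℝ (Fin 3)} (hu : u ∈ (chartOne M).target) :
    mfderiv (𝓡 3) (𝓡 3) (chartOne M).symm u (fieldInChart v u) =
      mulInvariantVectorField v ((chartOne M).symm u) :=
  (isInvertible_mfderiv_chartOne_symm hu).self_apply_inverse _

theorem contDiffOn_fieldInChart (v : GroupLieAlgebra (𝓡 3) M) :
    ContDiffOn ℝ ∞ (fieldInChart v) (chartOne M).target := fun u hu ↦ by
  have h := ContMDiffAt.mpullback_vectorField_preimage (m := ∞) (n := ∞) (x₀ := u)
    (contMDiff_infty_mulInvariantVectorField v).contMDiffAt (contMDiffAt_chartOne_symm hu)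
    (isInvertible_mfderiv_chartOne_symm hu) (by simp)
  exact (contMDiffAt_vectorSpace_iff_contDiffAt.1 h).contDiffWithinAt

variable [RiemannianBundle (fun x : M ↦ TangentSpace (𝓡 3) x)]
  [IsContMDiffRiemannianBundle (𝓡 3) ∞ (EuclideanSpace ℝ (Fin 3))
    (fun x : M ↦ TangentSpace (𝓡 3) x)]
  {cov : CovariantDerivative (𝓡 3) (EuclideanSpace ℝ (Fin 3))
    (fun x : M ↦ TangentSpace (𝓡 3) x)} {E : Fin 3 → GroupLieAlgebra (𝓡 3) M}

/-- The left-hand side is the bracket of the fields in the chart. Brackets commute with pullback,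
and vanishing torsion supplies the structure constants. -/
theorem IsLeviCivita.fderiv_fieldInChart_sub (hM : IsLeftInvariantMetric M)
    (hcov : IsLeviCivita cov) (hE : IsOrthonormalFrame E) {u : EuclideanSpace ℝ (Fin 3)}
    (hu : u ∈ (chartOne M).target) (i j : Fin 3) :
    fderiv ℝ (fieldInChart (E i)) u (fieldInChart (E j) u) -
      fderiv ℝ (fieldInChart (E j)) u (fieldInChart (E i) u) =
      ∑ k, (christoffel cov E j i k - christoffel cov E i j k) • fieldInChart (E k) u := by
  have h := VectorField.mpullback_mlieBracket (n := ∞) (x₀ := u)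
    (mdifferentiableAt_leftField E j ((chartOne M).symm u))
    (mdifferentiableAt_leftField E i ((chartOne M).symm u))
    (contMDiffAt_chartOne_symm hu) (by
      rw [minSmoothness_of_isRCLikeNormedField]
      exact ENat.LEInfty.out)
  have hbr : VectorField.mlieBracket (𝓡 3) (fieldInChart (E j)) (fieldInChart (E i)) =
      VectorField.lieBracket ℝ (fieldInChart (E j)) (fieldInChart (E i)) :=
    VectorField.mlieBracketWithin_univ.symm.trans
      (VectorField.mlieBracketWithin_eq_lieBracketWithin.trans VectorField.lieBracketWithin_univ)
  refine (congrFun hbr u).symm.trans (h.symm.trans ?_)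
  simp only [VectorField.mpullback, hcov.mlieBracket_eq_sum hM hE, map_sum, map_smul]
  rfl

/-- Local solutions of the equation `g⁻¹ dg = 2 Re(A dz)` under the Maurer–Cartan equation. -/
theorem exists_local_solution (hM : IsLeftInvariantMetric M)
    (hcov : IsLeviCivita cov) (hE : IsOrthonormalFrame E) {A : ℂ → Fin 3 → ℂ} {O : Set ℂ}
    (hO : IsOpen O) (hA : ∀ i, ContDiffOn ℝ ∞ (fun x ↦ A x i) O)
    (hMC : ∀ w ∈ O, ∀ l, (wirtinger (fun x ↦ conj (A x l)) w +
      ∑ i, ∑ j, A w i * conj (A w j) * (christoffel cov E i j l : ℂ)).im = 0) {w₀ : ℂ}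
    (hw₀ : w₀ ∈ O) :
    ∃ g : ℂ → M, ∀ᶠ w in 𝓝 w₀, ContMDiffAt 𝓘(ℝ, ℂ) (𝓡 3) ∞ g w ∧
      ∀ h : ℂ, mfderiv 𝓘(ℝ, ℂ) (𝓡 3) g w h =
        ∑ i, (2 * (A w i * h).re) • leftField E i (g w) := by
  set X : Fin 3 → EuclideanSpace ℝ (Fin 3) → EuclideanSpace ℝ (Fin 3) :=
    fun i ↦ fieldInChart (E i) with hX
  set T := (chartOne M).target with hT
  have hTo : IsOpen T := (chartOne M).open_target
  let F : ℂ × EuclideanSpace ℝ (Fin 3) → ℂ →L[ℝ] EuclideanSpace ℝ (Fin 3) := fun p ↦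
    ∑ i, (rePairing (A p.1 i)).smulRight (X i p.2)
  have hFapp (p h) : F p h = ∑ i, rePairing (A p.1 i) h • X i p.2 := by
    simp [F]
  have hXs (i) : ContDiffOn ℝ ∞ (X i) T := contDiffOn_fieldInChart (E i)
  have hF : ContDiffOn ℝ ∞ F (O ×ˢ T) := by
    refine ContDiffOn.sum fun i _ ↦ ?_
    have h1 : ContDiffOn ℝ ∞ (fun p : ℂ × EuclideanSpace ℝ (Fin 3) ↦ A p.1 i) (O ×ˢ T) :=
      (hA i).comp contDiffOn_fst fun p hp ↦ hp.1
    have h2 : ContDiffOn ℝ ∞ (fun p : ℂ × EuclideanSpace ℝ (Fin 3) ↦ X i p.2) (O ×ˢ T) :=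
      (hXs i).comp contDiffOn_snd fun p hp ↦ hp.2
    exact (rePairing.contDiff.comp_contDiffOn h1).smulRight h2
  have hAd {w} (hw : w ∈ O) (i) : DifferentiableAt ℝ (fun x ↦ A x i) w :=
    ((hA i).contDiffAt (hO.mem_nhds hw)).differentiableAt (by simp)
  have hXd {u} (hu : u ∈ T) (i) : DifferentiableAt ℝ (X i) u :=
    ((hXs i).contDiffAt (hTo.mem_nhds hu)).differentiableAt (by simp)
  have hFd (w u) (hw : w ∈ O) (hu : u ∈ T) (h ξ k) : fderiv ℝ F (w, u) (h, ξ) k =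
      ∑ i, (rePairing (A w i) k • fderiv ℝ (X i) u ξ +
        rePairing (fderiv ℝ (fun x ↦ A x i) w h) k • X i u) := by
    have hd : DifferentiableAt ℝ F (w, u) :=
      (hF.contDiffAt ((hO.prod hTo).mem_nhds ⟨hw, hu⟩)).differentiableAt (by simp)
    have e1 : fderiv ℝ F (w, u) (h, ξ) k = fderiv ℝ (fun p ↦ F p k) (w, u) (h, ξ) := by
      have := (hd.hasFDerivAt.clm_apply (hasFDerivAt_const k (w, u))).fderiv
      rw [this]
      simp
    have e2 : HasFDerivAt (fun p ↦ F p k) (∑ i, (rePairing (A w i) k •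
        (fderiv ℝ (X i) u ∘L ContinuousLinearMap.snd ℝ ℂ (EuclideanSpace ℝ (Fin 3))) +
        ((rePairing.flip k ∘L fderiv ℝ (fun x ↦ A x i) w) ∘L
          ContinuousLinearMap.fst ℝ ℂ (EuclideanSpace ℝ (Fin 3))).smulRight (X i u))) (w, u) := by
      simp only [hFapp]
      refine HasFDerivAt.fun_sum fun i _ ↦ ?_
      have h1 : HasFDerivAt (fun p : ℂ × EuclideanSpace ℝ (Fin 3) ↦ rePairing (A p.1 i) k)
          ((rePairing.flip k ∘L fderiv ℝ (fun x ↦ A x i) w) ∘L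
            ContinuousLinearMap.fst ℝ ℂ (EuclideanSpace ℝ (Fin 3))) (w, u) :=
        HasFDerivAt.comp (g := fun x ↦ rePairing (A x i) k) (w, u)
          ((rePairing.flip k).hasFDerivAt.comp w (hAd hw i).hasFDerivAt) hasFDerivAt_fst
      have h2 : HasFDerivAt (fun p : ℂ × EuclideanSpace ℝ (Fin 3) ↦ X i p.2)
          (fderiv ℝ (X i) u ∘L ContinuousLinearMap.snd ℝ ℂ (EuclideanSpace ℝ (Fin 3))) (w, u) :=
        HasFDerivAt.comp (g := X i) (w, u) (hXd hu i).hasFDerivAt hasFDerivAt_snd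
      exact h1.smul h2
    rw [e1, e2.fderiv]
    simp
  -- Exchanging `h` and `k` leaves brackets of the `X i` and exterior derivatives of the forms. The
  -- structure constants make these cancel by the structure equation.
  have hint (w u) (hw : w ∈ O) (hu : u ∈ T) (h k) :
      fderiv ℝ F (w, u) (h, F (w, u) h) k = fderiv ℝ F (w, u) (k, F (w, u) k) h := by
    rw [hFd w u hw hu, hFd w u hw hu, hFapp, hFapp, ← sub_eq_zero]
    have hbr (i j) := hcov.fderiv_fieldInChart_sub hM hE hu i j
    have hs (l) := rePairing_structure_equation (hAd hw) (hMC w hw l) h k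
    have e3 (h k : ℂ) : ∑ i, rePairing (A w i) k • fderiv ℝ (X i) u
        (∑ j, rePairing (A w j) h • X j u) =
        ∑ i, ∑ j, (rePairing (A w i) k * rePairing (A w j) h) • fderiv ℝ (X i) u (X j u) := by
      simp only [map_sum, map_smul, Finset.smul_sum, smul_smul]
    have e4 : ∑ i, ∑ j, (rePairing (A w i) h * rePairing (A w j) k) • fderiv ℝ (X i) u (X j u) =
        ∑ i, ∑ j, (rePairing (A w i) k * rePairing (A w j) h) • fderiv ℝ (X j) u (X i u) := by
      rw [Finset.sum_comm]
      simp only [mul_comm]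
    have e5 : ∑ i, ∑ j, (rePairing (A w i) k * rePairing (A w j) h) • fderiv ℝ (X i) u (X j u) -
        ∑ i, ∑ j, (rePairing (A w i) k * rePairing (A w j) h) • fderiv ℝ (X j) u (X i u) =
        ∑ l, (∑ i, ∑ j, rePairing (A w i) k * rePairing (A w j) h *
          (christoffel cov E j i l - christoffel cov E i j l)) • X l u := by
      simp only [← Finset.sum_sub_distrib, Finset.sum_smul]
      rw [Finset.sum_comm (f := fun l i ↦ ∑ j, _)]
      refine Finset.sum_congr rfl fun i _ ↦ ?_
      rw [Finset.sum_comm]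
      refine Finset.sum_congr rfl fun j _ ↦ ?_
      rw [← smul_sub, hbr, Finset.smul_sum]
      simp only [smul_smul, hX]
    rw [Finset.sum_add_distrib, Finset.sum_add_distrib, e3, e3, e4, add_sub_add_comm, e5,
      ← Finset.sum_sub_distrib, ← Finset.sum_add_distrib]
    refine Finset.sum_eq_zero fun l _ ↦ ?_
    rw [← sub_smul, ← add_smul, add_comm, hs l, zero_smul]
  have h1T : chartOne M 1 ∈ T := mem_chart_target _ _
  have hnhds : O ×ˢ T ∈ 𝓝 (w₀, chartOne M 1) := (hO.prod hTo).mem_nhds ⟨hw₀, h1T⟩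
  -- The initial value is the identity of the group, the centre of the chosen chart.
  obtain ⟨u, hu₀, hu⟩ := exists_eventually_hasFDerivAt_of_integrable (F := F) (x₀ := w₀)
    (w₀ := chartOne M 1) ((hF.contDiffAt hnhds).of_le ENat.LEInfty.out) (by
      filter_upwards [hnhds] with p hp h k using hint p.1 p.2 hp.1 hp.2 h k)
  have hcont : ContinuousAt u w₀ := hu.self_of_nhds.continuousAt
  have hTu : ∀ᶠ w in 𝓝 w₀, u w ∈ T := hcont.eventually (hTo.mem_nhds (by rwa [hu₀]))
  obtain ⟨s, hsub, hso, hws⟩ := eventually_nhds_iff.1 (hu.and (hTu.and (hO.mem_nhds hw₀)))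
  have husmooth : ContDiffOn ℝ ∞ u s := contDiffOn_infty_of_hasFDerivAt hF hso
    (fun x hx ↦ ⟨(hsub x hx).2.2, (hsub x hx).2.1⟩) (fun x hx ↦ (hsub x hx).1)
  refine ⟨fun w ↦ (chartOne M).symm (u w), ?_⟩
  filter_upwards [hso.mem_nhds hws] with w hw
  obtain ⟨hwd, hwT, hwO⟩ := hsub w hw
  have hsm := contMDiffAt_chartOne_symm hwT
  refine ⟨hsm.comp w (husmooth.contDiffAt (hso.mem_nhds hw)).contMDiffAt, fun h ↦ ?_⟩
  have hcomp := mfderiv_comp_apply (I := 𝓘(ℝ, ℂ)) (I' := 𝓡 3) (I'' := 𝓡 3) w (v := h) (f := u)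
    (g := (chartOne M).symm) (hsm.mdifferentiableAt (by simp)) hwd.differentiableAt.mdifferentiableAt
  have hval : mfderiv 𝓘(ℝ, ℂ) (𝓡 3) u w h = ∑ i, rePairing (A w i) h • X i (u w) := by
    rw [mfderiv_eq_fderiv, hwd.fderiv]
    exact hFapp _ _
  refine hcomp.trans ((congrArg (mfderiv (𝓡 3) (𝓡 3) (chartOne M).symm (u w)) hval).trans
    ((map_sum _ _ _).trans (Finset.sum_congr rfl fun i _ ↦ ?_)))
  refine (map_smul _ _ _).trans ?_
  rw [rePairing_apply]
  exact congrArg _ (mfderiv_chartOne_symm_fieldInChart (E i) hwT)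

end LocalExistence

/-! ### The real smooth surface underlying the Riemann surface. -/

section RealStructure

open Filter
open scoped Topology

variable {S S' : Type*} [TopologicalSpace S] [ChartedSpace ℂ S] [TopologicalSpace S']
  [ChartedSpace ℂ S']

/-- Holomorphic maps are smooth in the real sense. -/
theorem ContMDiffAt.real_of_complex {f : S → S'} {x : S} (h : ContMDiffAt 𝓘(ℂ) 𝓘(ℂ) ω f x) :
    ContMDiffAt 𝓘(ℝ, ℂ) 𝓘(ℝ, ℂ) ∞ f x := by
  rw [contMDiffAt_iff] at h ⊢
  exact ⟨h.1, (h.2.restrict_scalars ℝ).of_le le_top⟩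

/-- The real differential of a holomorphic map is its complex differential. -/
theorem HasMFDerivAt.real_of_complex {f : S → S'} {x : S}
    {f' : TangentSpace 𝓘(ℂ) x →L[ℂ] TangentSpace 𝓘(ℂ) (f x)}
    (h : HasMFDerivAt 𝓘(ℂ) 𝓘(ℂ) f x f') :
    HasMFDerivAt 𝓘(ℝ, ℂ) 𝓘(ℝ, ℂ) f x
      (ContinuousLinearMap.restrictScalars ℝ (show ℂ →L[ℂ] ℂ from f') : ℂ →L[ℝ] ℂ) :=
  ⟨h.1, HasFDerivWithinAt.restrictScalars ℝ h.2⟩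

variable [IsManifold 𝓘(ℂ) ω S]

instance instIsManifoldRealOfComplex : IsManifold 𝓘(ℝ, ℂ) ∞ S := by
  refine isManifold_of_contDiffOn 𝓘(ℝ, ℂ) ∞ S fun e e' he he' ↦ ?_
  have h := ((contDiffGroupoid ω 𝓘(ℂ)).compatible he he')
  rw [contDiffGroupoid, mem_groupoid_of_pregroupoid] at h
  exact (h.1.restrict_scalars ℝ).of_le le_top

theorem conformalCharts.mem_maximalAtlas_real {e : OpenPartialHomeomorph S ℂ}
    (he : e ∈ conformalCharts S) : e ∈ IsManifold.maximalAtlas 𝓘(ℝ, ℂ) ∞ S := by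
  refine e.mem_maximalAtlas_of_contMDiffOn (fun x hx ↦ ?_) (fun x hx ↦ ?_)
  · exact (contMDiffAt_of_mem_maximalAtlas he hx).real_of_complex.contMDiffWithinAt
  · exact (contMDiffAt_symm_of_mem_maximalAtlas he hx).real_of_complex.contMDiffWithinAt

omit [IsManifold 𝓘(ℂ) ω S] in
theorem conformalCharts.hasMFDerivAt_symm {e : OpenPartialHomeomorph S ℂ}
    (he : e ∈ conformalCharts S) {w : ℂ} (hw : w ∈ e.target) :
    HasMFDerivAt 𝓘(ℂ) 𝓘(ℂ) e.symm w (mfderiv 𝓘(ℂ) 𝓘(ℂ) e.symm w) :=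
  ((contMDiffAt_symm_of_mem_maximalAtlas he hw).mdifferentiableAt (by simp)).hasMFDerivAt

theorem conformalCharts.mdifferentiable_real {e : OpenPartialHomeomorph S ℂ}
    (he : e ∈ conformalCharts S) : e.MDifferentiable 𝓘(ℝ, ℂ) 𝓘(ℝ, ℂ) :=
  ⟨fun _ hx ↦ (contMDiffAt_of_mem_maximalAtlas (mem_maximalAtlas_real he) hx).mdifferentiableAt
      (by simp) |>.mdifferentiableWithinAt,
    fun _ hx ↦ (contMDiffAt_symm_of_mem_maximalAtlas (mem_maximalAtlas_real he)
      hx).mdifferentiableAt (by simp) |>.mdifferentiableWithinAt⟩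

omit [IsManifold 𝓘(ℂ) ω S] in
/-- The coordinate vectors are the values of the complex differential of the parametrization. -/
theorem coordVec_eq_mfderiv_complex {e : OpenPartialHomeomorph S ℂ} (he : e ∈ conformalCharts S)
    {w : ℂ} (hw : w ∈ e.target) (u : ℂ) :
    coordVec e w u = (mfderiv 𝓘(ℂ) 𝓘(ℂ) e.symm w u : ℂ) := by
  have h := (conformalCharts.hasMFDerivAt_symm he hw).real_of_complex.mfderiv
  exact congrArg (fun L : ℂ →L[ℝ] ℂ ↦ L u) h

omit [IsManifold 𝓘(ℂ) ω S] in
-- Complex linearity, that is, type `(1,0)`: the value on one coordinate vector determines the form.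
theorem FormTriple.apply_coordVec (a : FormTriple S) {e : OpenPartialHomeomorph S ℂ}
    (he : e ∈ conformalCharts S) {w : ℂ} (hw : w ∈ e.target) (u : ℂ) (i : Fin 3) :
    a i (e.symm w) (coordVec e w u) = a.coeff e w i * u := by
  have h1 : (mfderiv 𝓘(ℂ) 𝓘(ℂ) e.symm w u : ℂ) = u • mfderiv 𝓘(ℂ) 𝓘(ℂ) e.symm w (1 : ℂ) := by
    refine Eq.trans ?_ (map_smul (mfderiv 𝓘(ℂ) 𝓘(ℂ) e.symm w) u (1 : ℂ))
    congr 1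
    exact (mul_one u).symm
  refine (congrArg (a i (e.symm w)) ((coordVec_eq_mfderiv_complex he hw u).trans h1)).trans ?_
  exact (map_smul (a i (e.symm w)) u _).trans (mul_comm _ _)

/-- A local conformal parameter identifies `ℂ` with the tangent planes of the surface. -/
noncomputable def coordEquiv {e : OpenPartialHomeomorph S ℂ} (he : e ∈ conformalCharts S) {w : ℂ}
    (hw : w ∈ e.target) : ℂ ≃L[ℝ] TangentSpace 𝓘(ℝ, ℂ) (e.symm w) :=
  (conformalCharts.mdifferentiable_real he).symm.mfderiv hw

theorem exists_coordVec_eq {e : OpenPartialHomeomorph S ℂ} (he : e ∈ conformalCharts S) {w : ℂ}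
    (hw : w ∈ e.target) (v : TangentSpace 𝓘(ℝ, ℂ) (e.symm w)) : ∃ u, coordVec e w u = v :=
  (coordEquiv he hw).surjective v

theorem mfderiv_coordVec {e : OpenPartialHomeomorph S ℂ} (he : e ∈ conformalCharts S) {w : ℂ}
    (hw : w ∈ e.target) (u : ℂ) :
    (mfderiv 𝓘(ℝ, ℂ) 𝓘(ℝ, ℂ) e (e.symm w) (coordVec e w u) : ℂ) = u :=
  congrArg (fun L : ℂ →L[ℝ] ℂ ↦ L u)
    ((conformalCharts.mdifferentiable_real he).comp_symm_deriv hw)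

theorem FormTriple.coeff_mul_mfderiv (a : FormTriple S) {e : OpenPartialHomeomorph S ℂ}
    (he : e ∈ conformalCharts S) {p : S} (hp : p ∈ e.source) (v : TangentSpace 𝓘(ℝ, ℂ) p)
    {u : ℂ} (hu : mfderiv 𝓘(ℝ, ℂ) 𝓘(ℝ, ℂ) e p v = u) (i : Fin 3) :
    a.coeff e (e p) i * u = a i p v := by
  obtain ⟨w, hw, rfl⟩ : ∃ w ∈ e.target, e.symm w = p := ⟨e p, e.map_source hp, e.left_inv hp⟩
  obtain ⟨u', rfl⟩ := exists_coordVec_eq he hw v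
  obtain rfl : u' = u := (mfderiv_coordVec he hw u').symm.trans hu
  have h1 : a.coeff e (e (e.symm w)) i = a.coeff e w i := by rw [e.right_inv hw]
  rw [h1]
  exact (a.apply_coordVec he hw u' i).symm

theorem ContMDiff.contDiffOn_comp_symm {F : Type*} [NormedAddCommGroup F] [NormedSpace ℝ F]
    {f : S → F} (hf : ContMDiff 𝓘(ℝ, ℂ) 𝓘(ℝ, F) ∞ f) {e : OpenPartialHomeomorph S ℂ}
    (he : e ∈ conformalCharts S) : ContDiffOn ℝ ∞ (fun w ↦ f (e.symm w)) e.target :=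
  fun _ hw ↦ ((hf _).comp _ (contMDiffAt_symm_of_mem_maximalAtlas
    (conformalCharts.mem_maximalAtlas_real he) hw)).contDiffAt.contDiffWithinAt

/-- The differential of a function on the surface in a local conformal parameter. -/
theorem mfderiv_coordVec_eq_fderiv {f : S → ℝ} (hf : ContMDiff 𝓘(ℝ, ℂ) 𝓘(ℝ, ℝ) ∞ f)
    {e : OpenPartialHomeomorph S ℂ} (he : e ∈ conformalCharts S) {w : ℂ} (hw : w ∈ e.target)
    (u : ℂ) : (mfderiv 𝓘(ℝ, ℂ) 𝓘(ℝ, ℝ) f (e.symm w) (coordVec e w u) : ℝ) =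
      fderiv ℝ (fun x ↦ f (e.symm x)) w u := by
  have h := mfderiv_comp_apply (I := 𝓘(ℝ, ℂ)) (I' := 𝓘(ℝ, ℂ)) (I'' := 𝓘(ℝ, ℝ)) w (v := u)
    (f := e.symm) (g := f) ((hf _).mdifferentiableAt (by simp))
    ((conformalCharts.mdifferentiable_real he).symm.mdifferentiableAt hw)
  refine h.symm.trans ?_
  rw [mfderiv_eq_fderiv]
  rfl

end RealStructure

/-! ### Maps with prescribed left logarithmic derivative. -/

section LeftDerivative

open Filter
open scoped Topology

variable {M : Type*} [TopologicalSpace M] [ChartedSpace (EuclideanSpace ℝ (Fin 3)) M] [Group M]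
  {S : Type*} [TopologicalSpace S] [ChartedSpace ℂ S]

/-- `φ` is smooth at `p`, and `φ⁻¹ dφ = 2 Re ∑ a_i E_i` there. -/
structure HasLeftDerivAt (E : Fin 3 → GroupLieAlgebra (𝓡 3) M) (a : FormTriple S) (φ : S → M)
    (p : S) : Prop where
  contMDiffAt : ContMDiffAt 𝓘(ℝ, ℂ) (𝓡 3) ∞ φ p
  mfderiv_eq : ∀ v : TangentSpace 𝓘(ℝ, ℂ) p, mfderiv 𝓘(ℝ, ℂ) (𝓡 3) φ p v =
    ∑ i, (2 * (a i p v).re) • leftField E i (φ p)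

variable {E : Fin 3 → GroupLieAlgebra (𝓡 3) M} {a : FormTriple S} {φ ψ : S → M} {p : S}

theorem HasLeftDerivAt.congr (h : HasLeftDerivAt E a φ p) (hψ : ψ =ᶠ[𝓝 p] φ) :
    HasLeftDerivAt E a ψ p := by
  refine ⟨h.contMDiffAt.congr_of_eventuallyEq hψ, fun v ↦ ?_⟩
  have h1 := congrArg (fun L : ℂ →L[ℝ] EuclideanSpace ℝ (Fin 3) ↦ L v)
    (hψ.mfderiv_eq (I := 𝓘(ℝ, ℂ)) (I' := 𝓡 3))
  refine h1.trans ((h.mfderiv_eq v).trans ?_)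
  have h2 : ∀ q, q = ψ p → (∑ i, (2 * (a i p v).re) • leftField E i q : EuclideanSpace ℝ (Fin 3)) =
      ∑ i, (2 * (a i p v).re) • leftField E i (ψ p) := by
    rintro _ rfl
    rfl
  exact h2 _ hψ.self_of_nhds.symm

variable [LieGroup (𝓡 3) ∞ M]

theorem mfderiv_mul_left_sum (c : Fin 3 → ℝ) (m q : M) :
    mfderiv (𝓡 3) (𝓡 3) (fun x ↦ m * x) q (∑ i, c i • leftField E i q) =
      ∑ i, c i • leftField E i (m * q) :=
  (map_sum _ _ _).trans (Finset.sum_congr rfl fun i _ ↦ (map_smul _ _ _).trans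
    (congrArg (c i • ·) (mfderiv_mul_left_mulInvariantVectorField (E i) m q)))

theorem HasLeftDerivAt.mul_left (h : HasLeftDerivAt E a φ p) (m : M) :
    HasLeftDerivAt E a (fun q ↦ m * φ q) p := by
  refine ⟨contMDiffAt_const.mul h.contMDiffAt, fun v ↦ ?_⟩
  have h1 := mfderiv_comp_apply (I := 𝓘(ℝ, ℂ)) (I' := 𝓡 3) (I'' := 𝓡 3) p (v := v)
    (f := φ) (g := fun x ↦ m * x) (mdifferentiable_mul_left' m _)
    (h.contMDiffAt.mdifferentiableAt (by simp))
  exact h1.trans ((congrArg _ (h.mfderiv_eq v)).trans (mfderiv_mul_left_sum _ m (φ p)))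

theorem injective_mfderiv_mul_right (m q : M) :
    Function.Injective (mfderiv (𝓡 3) (𝓡 3) (fun x : M ↦ x * m) q) := by
  have hd (m : M) : MDifferentiable (𝓡 3) (𝓡 3) (fun x : M ↦ x * m) :=
    (contMDiff_mul_right (I := 𝓡 3) (n := ∞)).mdifferentiable (by simp)
  refine Function.LeftInverse.injective
    (g := mfderiv (𝓡 3) (𝓡 3) (fun x : M ↦ x * m⁻¹) (q * m)) fun v ↦ ?_
  have h := mfderiv_comp_apply (I := 𝓡 3) (I' := 𝓡 3) (I'' := 𝓡 3) q (v := v)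
    (f := fun x ↦ x * m) (g := fun x ↦ x * m⁻¹) (hd _ _) (hd _ _)
  have h2 : ((fun x : M ↦ x * m⁻¹) ∘ fun x ↦ x * m) = id := by
    ext x
    simp
  rw [h2] at h
  exact h.symm.trans (congrArg (fun L : EuclideanSpace ℝ (Fin 3) →L[ℝ] EuclideanSpace ℝ (Fin 3) ↦
    L v) mfderiv_id)

/-- Apply the product rule to `φ = f ψ` with `f = φ ψ⁻¹`. Left translation by `f p` carries `dψ` to
`dφ`, so the term with `df` vanishes, and right translation has injective differential. -/
theorem HasLeftDerivAt.mfderiv_mul_inv_eq_zero (hφ : HasLeftDerivAt E a φ p)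
    (hψ : HasLeftDerivAt E a ψ p) (v : TangentSpace 𝓘(ℝ, ℂ) p) :
    mfderiv 𝓘(ℝ, ℂ) (𝓡 3) (fun q ↦ φ q * (ψ q)⁻¹) p v = 0 := by
  set f : S → M := fun q ↦ φ q * (ψ q)⁻¹ with hf
  have hfs : ContMDiffAt 𝓘(ℝ, ℂ) (𝓡 3) ∞ f p := hφ.contMDiffAt.mul hψ.contMDiffAt.inv
  have hfd : MDifferentiableAt 𝓘(ℝ, ℂ) (𝓡 3) f p := hfs.mdifferentiableAt (by simp)
  have hψd : MDifferentiableAt 𝓘(ℝ, ℂ) (𝓡 3) ψ p := hψ.contMDiffAt.mdifferentiableAt (by simp)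
  have hmul : MDifferentiableAt ((𝓡 3).prod (𝓡 3)) (𝓡 3) (fun x : M × M ↦ x.1 * x.2)
      (f p, ψ p) := (contMDiff_mul (𝓡 3) ∞).mdifferentiableAt (by simp)
  have h1 := mfderiv_comp_apply (I := 𝓘(ℝ, ℂ)) (I' := (𝓡 3).prod (𝓡 3)) (I'' := 𝓡 3) p (v := v)
    (f := fun q ↦ (f q, ψ q)) (g := fun x : M × M ↦ x.1 * x.2) hmul (hfd.prodMk hψd)
  have h2 : ((fun x : M × M ↦ x.1 * x.2) ∘ fun q ↦ (f q, ψ q)) = φ := by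
    ext q
    simp [hf]
  have h3 : mfderiv 𝓘(ℝ, ℂ) ((𝓡 3).prod (𝓡 3)) (fun q ↦ (f q, ψ q)) p v =
      (mfderiv 𝓘(ℝ, ℂ) (𝓡 3) f p v, mfderiv 𝓘(ℝ, ℂ) (𝓡 3) ψ p v) :=
    congrArg (fun L : ℂ →L[ℝ] EuclideanSpace ℝ (Fin 3) × EuclideanSpace ℝ (Fin 3) ↦ L v)
      (mfderiv_prodMk hfd hψd)
  have h4 := mfderiv_prod_eq_add_apply (I := 𝓡 3) (I' := 𝓡 3) (I'' := 𝓡 3) hmul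
    (v := (mfderiv 𝓘(ℝ, ℂ) (𝓡 3) f p v, mfderiv 𝓘(ℝ, ℂ) (𝓡 3) ψ p v))
  have h5 : mfderiv (𝓡 3) (𝓡 3) (fun x ↦ f p * x) (ψ p) (mfderiv 𝓘(ℝ, ℂ) (𝓡 3) ψ p v) =
      ∑ i, (2 * (a i p v).re) • leftField E i (f p * ψ p) :=
    (congrArg _ (hψ.mfderiv_eq v)).trans (mfderiv_mul_left_sum _ (f p) (ψ p))
  have h6 : ∀ q, q = φ p → (∑ i, (2 * (a i p v).re) • leftField E i q : EuclideanSpace ℝ (Fin 3)) =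
      ∑ i, (2 * (a i p v).re) • leftField E i (φ p) := by
    rintro _ rfl
    rfl
  have h7 := (congrFun (congrArg (fun g : S → M ↦
    (fun w : ℂ ↦ (mfderiv 𝓘(ℝ, ℂ) (𝓡 3) g p w : EuclideanSpace ℝ (Fin 3)))) h2) v).symm
  have key : ∀ P R D : EuclideanSpace ℝ (Fin 3), P = R + D → D = P → R = 0 := by
    rintro P R _ h rfl
    exact right_eq_add.1 h
  have h8 := key _ _ _ (h7.trans (h1.trans ((congrArg _ h3).trans h4)))
    (h5.trans ((h6 _ (by simp [hf])).trans (hφ.mfderiv_eq v).symm))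
  exact injective_mfderiv_mul_right (ψ p) (f p) (h8.trans (map_zero _).symm)

/-- A map with vanishing differential is locally constant. -/
theorem eventually_eq_of_mfderiv_eq_zero [IsManifold 𝓘(ℂ) ω S] {f : S → M} {x : S}
    (hf : ∀ᶠ y in 𝓝 x, ContMDiffAt 𝓘(ℝ, ℂ) (𝓡 3) ∞ f y ∧
      ∀ v : TangentSpace 𝓘(ℝ, ℂ) y, mfderiv 𝓘(ℝ, ℂ) (𝓡 3) f y v = 0) :
    ∀ᶠ y in 𝓝 x, f y = f x := by
  set e := chartAt ℂ x with he
  set c := chartAt (EuclideanSpace ℝ (Fin 3)) (f x) with hc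
  have hxe : x ∈ e.source := mem_chart_source _ _
  have hec : e ∈ conformalCharts S := IsManifold.chart_mem_maximalAtlas x
  have hcont : ContinuousAt f x := hf.self_of_nhds.1.continuousAt
  have hcs : ∀ᶠ y in 𝓝 x, f y ∈ c.source :=
    hcont.eventually (c.open_source.mem_nhds (mem_chart_source _ _))
  have hsymm : Tendsto e.symm (𝓝 (e x)) (𝓝 x) := by
    have := (e.continuousAt_symm (e.map_source hxe)).tendsto
    rwa [e.left_inv hxe] at this
  have hev : ∀ᶠ w in 𝓝 (e x), w ∈ e.target ∧ f (e.symm w) ∈ c.source ∧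
      HasFDerivAt (fun w ↦ c (f (e.symm w))) (0 : ℂ →L[ℝ] EuclideanSpace ℝ (Fin 3)) w := by
    filter_upwards [hsymm.eventually hf, hsymm.eventually hcs,
      e.open_target.mem_nhds (e.map_source hxe)] with w h1 h2 hw
    refine ⟨hw, h2, ?_⟩
    have hs : MDifferentiableAt 𝓘(ℝ, ℂ) 𝓘(ℝ, ℂ) e.symm w :=
      (conformalCharts.mdifferentiable_real hec).symm.mdifferentiableAt hw
    have hf1 : MDifferentiableAt 𝓘(ℝ, ℂ) (𝓡 3) f (e.symm w) := h1.1.mdifferentiableAt (by simp)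
    have hc1 : MDifferentiableAt (𝓡 3) (𝓡 3) c (f (e.symm w)) :=
      (mdifferentiable_chart (I := 𝓡 3) (f x)).mdifferentiableAt h2
    have h3 := hc1.hasMFDerivAt.comp w (hf1.hasMFDerivAt.comp w hs.hasMFDerivAt)
    refine (hasMFDerivAt_iff_hasFDerivAt.1 h3).congr_fderiv (ContinuousLinearMap.ext fun v ↦ ?_)
    exact (congrArg (mfderiv (𝓡 3) (𝓡 3) c (f (e.symm w))) (h1.2 _)).trans (map_zero _)
  obtain ⟨r, hr, hball⟩ := Metric.eventually_nhds_iff_ball.1 hev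
  have hconst {y z : ℂ} (hy : y ∈ Metric.ball (e x) r) (hz : z ∈ Metric.ball (e x) r) :
      c (f (e.symm y)) = c (f (e.symm z)) := Metric.isOpen_ball.is_const_of_fderiv_eq_zero (𝕜 := ℝ)
    (f := fun w ↦ c (f (e.symm w)))
    (convex_ball (e x) r).isPreconnected
    (fun w hw ↦ (hball w hw).2.2.differentiableAt.differentiableWithinAt)
    (fun w hw ↦ (hball w hw).2.2.fderiv) hy hz
  filter_upwards [e.open_source.mem_nhds hxe,
    (e.continuousAt hxe).eventually (Metric.ball_mem_nhds (e x) hr)] with y hy hyr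
  have h1 := hconst hyr (Metric.mem_ball_self hr)
  have h2 := (hball _ hyr).2.1
  simp only [e.left_inv hy, e.left_inv hxe] at h1 h2
  exact c.injOn h2 (mem_chart_source _ _) h1

/-- Maps with the same left logarithmic derivative differ locally by a left translation. -/
theorem eventually_mul_inv_eq [IsManifold 𝓘(ℂ) ω S] (hφ : ∀ᶠ y in 𝓝 p, HasLeftDerivAt E a φ y)
    (hψ : ∀ᶠ y in 𝓝 p, HasLeftDerivAt E a ψ y) :
    ∀ᶠ y in 𝓝 p, φ y * (ψ y)⁻¹ = φ p * (ψ p)⁻¹ := by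
  refine eventually_eq_of_mfderiv_eq_zero (f := fun y ↦ φ y * (ψ y)⁻¹) ?_
  filter_upwards [hφ, hψ] with y h1 h2
  exact ⟨h1.contMDiffAt.mul h2.contMDiffAt.inv, h1.mfderiv_mul_inv_eq_zero h2⟩

/-- Uniqueness up to left translation. -/
theorem exists_eq_mul_left [IsManifold 𝓘(ℂ) ω S] [PreconnectedSpace S] [Nonempty S]
    (hφ : ∀ y, HasLeftDerivAt E a φ y) (hψ : ∀ y, HasLeftDerivAt E a ψ y) :
    ∃ m : M, ψ = fun y ↦ m * φ y := by
  have hc : IsLocallyConstant fun y ↦ ψ y * (φ y)⁻¹ := by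
    rw [IsLocallyConstant.iff_eventually_eq]
    exact fun y ↦ eventually_mul_inv_eq (.of_forall hψ) (.of_forall hφ)
  inhabit S
  refine ⟨ψ default * (φ default)⁻¹, funext fun y ↦ ?_⟩
  rw [hc.apply_eq_of_preconnectedSpace default y]
  simp

/-- Local solutions of `φ⁻¹ dφ = 2 Re ∑ a_i E_i` exist everywhere if they exist locally. -/
theorem exists_hasLeftDerivAt_of_local [IsManifold 𝓘(ℂ) ω S] [SimplyConnectedSpace S]
    (h : ∀ x : S, ∃ φ : S → M, ∀ᶠ y in 𝓝 x, HasLeftDerivAt E a φ y) :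
    ∃ φ : S → M, ∀ y, HasLeftDerivAt E a φ y := by
  have : LocallyPathConnectedSpace S := ChartedSpace.locallyPathConnectedSpace ℂ S
  choose f hf using h
  choose U hU hUo hxU using fun x ↦ eventually_nhds_iff.1 (hf x)
  obtain ⟨φ, hφ⟩ := SimplyConnectedSpace.exists_eventually_mul_inv_eq U hUo hxU f
    fun i j x hx ↦ eventually_mul_inv_eq
      (Filter.mem_of_superset ((hUo i).mem_nhds hx.1) (hU i))
      (Filter.mem_of_superset ((hUo j).mem_nhds hx.2) (hU j))
  refine ⟨φ, fun y ↦ ?_⟩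
  refine ((hU y y (hxU y)).mul_left (φ y * (f y y)⁻¹)).congr ?_
  filter_upwards [hφ y y (hxU y)] with z hz
  rw [← hz]
  simp

omit [LieGroup (𝓡 3) ∞ M] in
/-- A left logarithmic derivative can be prescribed locally if it is so in the coefficients. -/
theorem exists_eventually_hasLeftDerivAt [IsManifold 𝓘(ℂ) ω S] {x : S} {g : ℂ → M}
    (hg : ∀ᶠ w in 𝓝 (chartAt ℂ x x), ContMDiffAt 𝓘(ℝ, ℂ) (𝓡 3) ∞ g w ∧
      ∀ h : ℂ, mfderiv 𝓘(ℝ, ℂ) (𝓡 3) g w h =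
        ∑ i, (2 * (a.coeff (chartAt ℂ x) w i * h).re) • leftField E i (g w)) :
    ∀ᶠ y in 𝓝 x, HasLeftDerivAt E a (fun y ↦ g (chartAt ℂ x y)) y := by
  set e := chartAt ℂ x with he
  have hxe : x ∈ e.source := mem_chart_source _ _
  have hec : e ∈ conformalCharts S := IsManifold.chart_mem_maximalAtlas x
  filter_upwards [(e.continuousAt hxe).eventually hg, e.open_source.mem_nhds hxe] with y h1 hy
  have hes := contMDiffAt_of_mem_maximalAtlas (conformalCharts.mem_maximalAtlas_real hec) hy
  refine ⟨h1.1.comp y hes, fun v ↦ ?_⟩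
  have h2 := mfderiv_comp_apply (I := 𝓘(ℝ, ℂ)) (I' := 𝓘(ℝ, ℂ)) (I'' := 𝓡 3) y (v := v)
    (f := e) (g := g) (h1.1.mdifferentiableAt (by simp)) (hes.mdifferentiableAt (by simp))
  refine h2.trans ((h1.2 _).trans (Finset.sum_congr rfl fun i _ ↦ ?_))
  exact congrArg (fun z : ℂ ↦ (2 * z.re) • leftField E i (g (e y)))
    (a.coeff_mul_mfderiv hec hy v rfl i)

end LeftDerivative

/-! ### Algebra of the second fundamental form and the shape operator. -/

section ShapeOperatorAlgebra

variable {n : Fin 3 → ℝ} {A W : Fin 3 → ℂ} {s : ℝ}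

theorem dotProduct_re_im_eq_zero (hA : (fun k ↦ (n k : ℂ)) ⬝ᵥ A = 0) :
    n 0 * (A 0).re + n 1 * (A 1).re + n 2 * (A 2).re = 0 ∧
      n 0 * (A 0).im + n 1 * (A 1).im + n 2 * (A 2).im = 0 := by
  constructor
  · simpa [dotProduct, Fin.sum_univ_three] using congrArg Complex.re hA
  · simpa [dotProduct, Fin.sum_univ_three] using congrArg Complex.im hA

/-- The second fundamental form in coordinates. -/
theorem neg_sum_re_mul_re (hW : W = (Complex.I * (s : ℂ)) • ((fun k ↦ (n k : ℂ)) ⨯₃ A))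
    (u v : ℂ) :
    ∑ k, -(2 * (W k * u).re) * (2 * (A k * v).re) =
      2 * (2 * s * (n ⬝ᵥ ((fun k ↦ (A k).im) ⨯₃ (fun k ↦ (A k).re)))) *
        (u * (starRingEnd ℂ) v).re := by
  subst hW
  simp [Fin.sum_univ_three, cross_apply, dotProduct]
  ring

/-- The cross product of two vectors orthogonal to a unit vector is a multiple of it. -/
theorem cross_eq_smul_of_orthogonal (hn : n ⬝ᵥ n = 1) (hA : (fun k ↦ (n k : ℂ)) ⬝ᵥ A = 0) :
    (fun k ↦ (A k).im) ⨯₃ (fun k ↦ (A k).re) =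
      (n ⬝ᵥ ((fun k ↦ (A k).im) ⨯₃ (fun k ↦ (A k).re))) • n := by
  obtain ⟨hx, hy⟩ := dotProduct_re_im_eq_zero hA
  simp only [dotProduct, Fin.sum_univ_three] at hn
  ext k
  fin_cases k <;> simp [cross_apply, dotProduct, Fin.sum_univ_three]
  · linear_combination -((A 1).im * (A 2).re - (A 2).im * (A 1).re) * hn -
      (n 1 * (A 2).im - n 2 * (A 1).im) * hx + (n 1 * (A 2).re - n 2 * (A 1).re) * hy
  · linear_combination -((A 2).im * (A 0).re - (A 0).im * (A 2).re) * hn -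
      (n 2 * (A 0).im - n 0 * (A 2).im) * hx + (n 2 * (A 0).re - n 0 * (A 2).re) * hy
  · linear_combination -((A 0).im * (A 1).re - (A 1).im * (A 0).re) * hn -
      (n 0 * (A 1).im - n 1 * (A 0).im) * hx + (n 0 * (A 1).re - n 1 * (A 0).re) * hy

/-- The shape operator in coordinates. -/
theorem exists_linearMap_det_eq (hn : n ⬝ᵥ n = 1) (hA : (fun k ↦ (n k : ℂ)) ⬝ᵥ A = 0)
    (hD : 0 < n ⬝ᵥ ((fun k ↦ (A k).im) ⨯₃ (fun k ↦ (A k).re)))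
    (hW : W = (Complex.I * (s : ℂ)) • ((fun k ↦ (n k : ℂ)) ⨯₃ A)) :
    ∃ B : ℂ →ₗ[ℝ] ℂ, (∀ u k, (A k * B u).re = -(W k * u).re) ∧ LinearMap.det B = s ^ 2 := by
  have hc := cross_eq_smul_of_orthogonal hn hA
  set D := n ⬝ᵥ ((fun k ↦ (A k).im) ⨯₃ (fun k ↦ (A k).re)) with hDdef
  clear_value D
  have hD0 : D ≠ 0 := hD.ne'
  have h0 : (A 1).im * (A 2).re - (A 2).im * (A 1).re = D * n 0 := by
    simpa [cross_apply] using congrFun hc 0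
  have h1 : (A 2).im * (A 0).re - (A 0).im * (A 2).re = D * n 1 := by
    simpa [cross_apply] using congrFun hc 1
  have h2 : (A 0).im * (A 1).re - (A 1).im * (A 0).re = D * n 2 := by
    simpa [cross_apply] using congrFun hc 2
  simp only [dotProduct, Fin.sum_univ_three] at hn
  set p := (A 0).im * (A 0).im + (A 1).im * (A 1).im + (A 2).im * (A 2).im with hp
  set q := (A 0).re * (A 0).im + (A 1).re * (A 1).im + (A 2).re * (A 2).im with hq
  set r := (A 0).re * (A 0).re + (A 1).re * (A 1).re + (A 2).re * (A 2).re with hr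
  -- In the basis `φ_x = 2 Re A`, `φ_y = -2 Im A` the first fundamental form has rows `4 (r, -q)`
  -- and `4 (-q, p)`, with determinant `16 D²`. The second is `4 s D` times the identity, so this
  -- matrix is `I⁻¹ II`.
  refine ⟨Matrix.toLin Complex.basisOneI Complex.basisOneI
    !![s / D * p, s / D * q; s / D * q, s / D * r], fun u k ↦ ?_, ?_⟩
  · have hB : Matrix.toLin Complex.basisOneI Complex.basisOneI
        !![s / D * p, s / D * q; s / D * q, s / D * r] u =
        ((s / D * (p * u.re + q * u.im) : ℝ) : ℂ) +
          ((s / D * (q * u.re + r * u.im) : ℝ) : ℂ) * Complex.I := by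
      rw [Matrix.toLin_apply]
      simp [Fin.sum_univ_two, Matrix.mulVec, dotProduct]
      ring
    rw [hB, hW]
    have hB2 (a : ℂ) (b c : ℝ) : (a * ((b : ℂ) + (c : ℂ) * Complex.I)).re = a.re * b - a.im * c := by
      simp
    rw [hB2]
    have key (l : ℝ) (h : (A k).re * (p * u.re + q * u.im) - (A k).im * (q * u.re + r * u.im) =
        D * l) : (A k).re * (s / D * (p * u.re + q * u.im)) -
          (A k).im * (s / D * (q * u.re + r * u.im)) = s * l := by
      field_simp
      linear_combination s * h
    fin_cases k <;> simp only [Fin.zero_eta, Fin.mk_one, Fin.reduceFinMk] at key ⊢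
    · rw [key ((n 1 * (A 2).im - n 2 * (A 1).im) * u.re +
        (n 1 * (A 2).re - n 2 * (A 1).re) * u.im)]
      · simp [cross_apply]
        ring
      · rw [hp, hq, hr]
        linear_combination ((A 2).im * u.re + (A 2).re * u.im) * h1 -
          ((A 1).im * u.re + (A 1).re * u.im) * h2
    · rw [key ((n 2 * (A 0).im - n 0 * (A 2).im) * u.re +
        (n 2 * (A 0).re - n 0 * (A 2).re) * u.im)]
      · simp [cross_apply]
        ring
      · rw [hp, hq, hr]
        linear_combination ((A 0).im * u.re + (A 0).re * u.im) * h2 -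
          ((A 2).im * u.re + (A 2).re * u.im) * h0
    · rw [key ((n 0 * (A 1).im - n 1 * (A 0).im) * u.re +
        (n 0 * (A 1).re - n 1 * (A 0).re) * u.im)]
      · simp [cross_apply]
        ring
      · rw [hp, hq, hr]
        linear_combination ((A 1).im * u.re + (A 1).re * u.im) * h0 -
          ((A 0).im * u.re + (A 0).re * u.im) * h1
  · rw [LinearMap.det_toLin, Matrix.det_fin_two_of]
    -- Lagrange's identity for the cross product of `Im A` and `Re A`, which equals `D n`.
    have h : p * r - q * q = D ^ 2 := by
      rw [hp, hq, hr]
      linear_combination ((A 1).im * (A 2).re - (A 2).im * (A 1).re + D * n 0) * h0 +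
        ((A 2).im * (A 0).re - (A 0).im * (A 2).re + D * n 1) * h1 +
        ((A 0).im * (A 1).re - (A 1).im * (A 0).re + D * n 2) * h2 + D ^ 2 * hn
    field_simp
    linear_combination s ^ 2 * h

end ShapeOperatorAlgebra

/-! ### Geometry of a map with the prescribed left derivative. -/

section PrescribedImmersion

variable {M : Type*} [TopologicalSpace M] [ChartedSpace (EuclideanSpace ℝ (Fin 3)) M] [Group M]
  {S : Type*} [TopologicalSpace S] [ChartedSpace ℂ S]
  {E : Fin 3 → GroupLieAlgebra (𝓡 3) M} {N : S → Fin 3 → ℝ} {K : S → ℝ} {a : FormTriple S}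
  {φ : S → M} {e : OpenPartialHomeomorph S ℂ} {w : ℂ}

theorem HasLeftDerivAt.mfderiv_coordVec (h : HasLeftDerivAt E a φ (e.symm w))
    (he : e ∈ conformalCharts S) (hw : w ∈ e.target) (u : ℂ) :
    mfderiv 𝓘(ℝ, ℂ) (𝓡 3) φ (e.symm w) (coordVec e w u) =
      ∑ i, (2 * (a.coeff e w i * u).re) • leftField E i (φ (e.symm w)) :=
  (h.mfderiv_eq _).trans (Finset.sum_congr rfl fun i _ ↦
    congrArg (fun z : ℂ ↦ (2 * z.re) • leftField E i (φ (e.symm w))) (a.apply_coordVec he hw u i))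

theorem contMDiff_component (hN : ContMDiff 𝓘(ℝ, ℂ) 𝓘(ℝ, Fin 3 → ℝ) ∞ N) (k : Fin 3) :
    ContMDiff 𝓘(ℝ, ℂ) 𝓘(ℝ, ℝ) ∞ fun p ↦ N p k :=
  contMDiff_pi_space.1 hN k

variable [RiemannianBundle (fun x : M ↦ TangentSpace (𝓡 3) x)]

theorem HasLeftDerivAt.phiZ_eq (h : HasLeftDerivAt E a φ (e.symm w)) (hE : IsOrthonormalFrame E)
    (he : e ∈ conformalCharts S) (hw : w ∈ e.target) : phiZ E φ e w = a.coeff e w := by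
  ext i
  rw [phiZ, h.mfderiv_coordVec he hw, h.mfderiv_coordVec he hw, hE.inner_sum_smul_left,
    hE.inner_sum_smul_left]
  apply Complex.ext <;> simp

/-- The real differential is `dφ(u) = 2 Re (φ_z u)`, and an orthonormal frame recovers it from its
components. -/
theorem HasDerivativeForm.hasLeftDerivAt [IsManifold 𝓘(ℂ) ω S] (h : HasDerivativeForm E a φ)
    (hE : IsOrthonormalFrame E) (hφ : ContMDiff 𝓘(ℝ, ℂ) (𝓡 3) ∞ φ) (p : S) :
    HasLeftDerivAt E a φ p := by
  obtain ⟨e, he, w, hw, rfl⟩ : ∃ e ∈ conformalCharts S, ∃ w ∈ e.target, e.symm w = p :=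
    ⟨chartAt ℂ p, IsManifold.chart_mem_maximalAtlas p, chartAt ℂ p p, mem_chart_target _ _,
      (chartAt ℂ p).left_inv (mem_chart_source _ _)⟩
  refine ⟨hφ _, fun v ↦ ?_⟩
  obtain ⟨u, rfl⟩ := exists_coordVec_eq he hw v
  have hlin : mfderiv 𝓘(ℝ, ℂ) (𝓡 3) φ (e.symm w) (coordVec e w u) =
      u.re • mfderiv 𝓘(ℝ, ℂ) (𝓡 3) φ (e.symm w) (coordVec e w 1) +
        u.im • mfderiv 𝓘(ℝ, ℂ) (𝓡 3) φ (e.symm w) (coordVec e w Complex.I) := by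
    let D : ℂ →L[ℝ] TangentSpace (𝓡 3) (φ (e.symm w)) :=
      (mfderiv 𝓘(ℝ, ℂ) (𝓡 3) φ (e.symm w)).comp (coordEquiv he hw : ℂ →L[ℝ] _)
    have h1 : u = u.re • 1 + u.im • Complex.I := by simp [Complex.re_add_im]
    have h2 : D u = u.re • D 1 + u.im • D Complex.I := by
      conv_lhs => rw [h1]
      rw [map_add, map_smul, map_smul]
    exact h2
  refine (hE.eq_sum _ _).trans (Finset.sum_congr rfl fun i _ ↦ ?_)
  congr 1
  rw [hlin, inner_add_left, inner_smul_left, inner_smul_left]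
  refine Eq.trans ?_ (congrArg (fun z : ℂ ↦ 2 * z.re) (a.apply_coordVec he hw u i).symm)
  have h3 := congrFun (h e he w hw) i
  rw [← h3, phiZ]
  simp
  ring

variable [LieGroup (𝓡 3) ∞ M] [IsContMDiffRiemannianBundle (𝓡 3) ∞ (EuclideanSpace ℝ (Fin 3))
    (fun x : M ↦ TangentSpace (𝓡 3) x)]
  {cov : CovariantDerivative (𝓡 3) (EuclideanSpace ℝ (Fin 3))
    (fun x : M ↦ TangentSpace (𝓡 3) x)}

/-- This identifies `covZ` with the components of the covariant derivative of the normal field along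
`∂_z`. -/
theorem HasLeftDerivAt.covAlong_coordVec [IsManifold 𝓘(ℂ) ω S]
    (h : HasLeftDerivAt E a φ (e.symm w))
    (hM : IsLeftInvariantMetric M) (hcov : IsLeviCivita cov) (hE : IsOrthonormalFrame E)
    (hN : ContMDiff 𝓘(ℝ, ℂ) 𝓘(ℝ, Fin 3 → ℝ) ∞ N) (he : e ∈ conformalCharts S)
    (hw : w ∈ e.target) (u : ℂ) :
    covAlong cov E φ N (e.symm w) (coordVec e w u) =
      ∑ k, (2 * (covZ (christoffel cov E) N a e w k * u).re) •
        leftField E k (φ (e.symm w)) := by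
  set Γ := christoffel cov E with hΓ
  set A := a.coeff e w with hA
  have h1 (j : Fin 3) : cov (leftField E j) (φ (e.symm w))
      (mfderiv 𝓘(ℝ, ℂ) (𝓡 3) φ (e.symm w) (coordVec e w u)) =
      ∑ k, (∑ i, 2 * (A i * u).re * Γ i j k) • leftField E k (φ (e.symm w)) := by
    rw [h.mfderiv_coordVec he hw, map_sum]
    simp only [map_smul, hcov.cov_leftField hM hE, Finset.smul_sum, smul_smul, Finset.sum_smul]
    rw [Finset.sum_comm]
  have h2 (j : Fin 3) : (mfderiv 𝓘(ℝ, ℂ) 𝓘(ℝ, ℝ) (fun q ↦ N q j) (e.symm w) (coordVec e w u) : ℝ) =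
      2 * (wirtinger (fun x ↦ (N (e.symm x) j : ℂ)) w * u).re := by
    have hd := contMDiff_component hN j
    refine (mfderiv_coordVec_eq_fderiv hd he hw u).trans (fderiv_eq_re_wirtinger ?_ u)
    exact ((hd.contDiffOn_comp_symm he).contDiffAt (e.open_target.mem_nhds hw)).differentiableAt
      (by simp)
  have h3 (k : Fin 3) : 2 * (covZ Γ N a e w k * u).re =
      2 * (wirtinger (fun x ↦ (N (e.symm x) k : ℂ)) w * u).re +
        ∑ j, N (e.symm w) j * ∑ i, 2 * (A i * u).re * Γ i j k := by
    simp only [covZ, ← hA, Fin.sum_univ_three]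
    simp
    ring
  simp only [h3, add_smul, Finset.sum_add_distrib, covAlong]
  congr 1
  · exact Finset.sum_congr rfl fun j _ ↦ congrArg (· • leftField E j (φ (e.symm w))) (h2 j)
  · simp only [h1, Finset.smul_sum, smul_smul, Finset.sum_smul, Finset.mul_sum]
    rw [Finset.sum_comm]

/-- The linear system and the orientation yield all the geometry; integrability serves only to
produce `φ`. -/
theorem isPrescribedImmersion_of_hasLeftDerivAt [IsManifold 𝓘(ℂ) ω S]
    (hM : IsLeftInvariantMetric M) (hcov : IsLeviCivita cov) (hE : IsOrthonormalFrame E)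
    (hN : ContMDiff 𝓘(ℝ, ℂ) 𝓘(ℝ, Fin 3 → ℝ) ∞ N) (hN_unit : ∀ p, N p ⬝ᵥ N p = 1)
    (hK_pos : ∀ p, 0 < K p) (h_system : SolvesLinearSystem (christoffel cov E) N K a)
    (h_oriented : IsPositivelyOriented N a) (hφ : ∀ p, HasLeftDerivAt E a φ p) :
    IsPrescribedImmersion cov E φ N K a := by
  have hex (p : S) : ∃ e ∈ conformalCharts S, ∃ w ∈ e.target, e.symm w = p :=
    ⟨chartAt ℂ p, IsManifold.chart_mem_maximalAtlas p, chartAt ℂ p p, mem_chart_target _ _,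
      (chartAt ℂ p).left_inv (mem_chart_source _ _)⟩
  have hNW {e : OpenPartialHomeomorph S ℂ} (he : e ∈ conformalCharts S) {w : ℂ}
      (hw : w ∈ e.target) := dotProduct_eq_zero_and_eq_cross (n := fun x ↦ N (e.symm x))
    (κ := fun x ↦ K (e.symm x)) (hcov.christoffel_skew hE) e.open_target
    (fun k ↦ ((contMDiff_component hN k).contDiffOn_comp_symm he).differentiableOn (by simp))
    (fun x _ ↦ hN_unit _) (fun x _ ↦ hK_pos _) (W := covZ (christoffel cov E) N a e)
    (fun x _ k ↦ rfl) (h_system e he) hw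
  have hII {e : OpenPartialHomeomorph S ℂ} (he : e ∈ conformalCharts S) {w : ℂ}
      (hw : w ∈ e.target) (u v : ℂ) :
      secondForm cov E φ N (e.symm w) (coordVec e w u) (coordVec e w v) =
        2 * (2 * √(K (e.symm w)) * (N (e.symm w) ⬝ᵥ ((fun k ↦ (a.coeff e w k).im) ⨯₃
          (fun k ↦ (a.coeff e w k).re)))) * (u * (starRingEnd ℂ) v).re := by
    rw [← neg_sum_re_mul_re (hNW he hw).2, secondForm,
      (hφ _).covAlong_coordVec hM hcov hE hN he hw, (hφ _).mfderiv_coordVec he hw, inner_neg_left,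
      hE.inner_sum_smul, dotProduct, ← Finset.sum_neg_distrib]
    simp only [neg_mul]
  have hρ {e : OpenPartialHomeomorph S ℂ} (he : e ∈ conformalCharts S) {w : ℂ}
      (hw : w ∈ e.target) : 0 < 2 * √(K (e.symm w)) * (N (e.symm w) ⬝ᵥ
        ((fun k ↦ (a.coeff e w k).im) ⨯₃ (fun k ↦ (a.coeff e w k).re))) :=
    mul_pos (mul_pos two_pos (Real.sqrt_pos.2 (hK_pos _))) (h_oriented e he w hw)
  have hpos (p : S) (v : TangentSpace 𝓘(ℝ, ℂ) p) (hv : v ≠ 0) :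
      0 < secondForm cov E φ N p v v := by
    obtain ⟨e, he, w, hw, rfl⟩ := hex p
    obtain ⟨u, rfl⟩ := exists_coordVec_eq he hw v
    rw [hII he hw]
    refine mul_pos (mul_pos two_pos (hρ he hw)) ?_
    rw [Complex.mul_conj, Complex.ofReal_re, Complex.normSq_pos]
    rintro rfl
    exact hv (map_zero (coordEquiv he hw))
  refine ⟨⟨fun p ↦ (hφ p).contMDiffAt, fun p ↦ ?_⟩, ⟨fun p ↦ ?_, fun p v ↦ ?_, hpos⟩, fun p ↦ ?_,
    fun e he w hw ↦ ⟨_, hρ he hw, hII he hw⟩, fun e he w hw ↦ (hφ _).phiZ_eq hE he hw⟩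
  · refine (injective_iff_map_eq_zero _).2 fun v hv ↦ ?_
    by_contra hv0
    have h := hpos p v hv0
    rw [secondForm, hv, inner_zero_right] at h
    exact h.false
  · rw [fieldAlong, hE.inner_sum_smul, hN_unit]
  · obtain ⟨e, he, w, hw, rfl⟩ := hex p
    obtain ⟨u, rfl⟩ := exists_coordVec_eq he hw v
    rw [fieldAlong, (hφ _).mfderiv_coordVec he hw, hE.inner_sum_smul]
    obtain ⟨hx, hy⟩ := dotProduct_re_im_eq_zero (hNW he hw).1
    simp [dotProduct, Fin.sum_univ_three]
    linear_combination 2 * u.re * hx - 2 * u.im * hy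
  · obtain ⟨e, he, w, hw, rfl⟩ := hex p
    obtain ⟨B, hB, hdet⟩ := exists_linearMap_det_eq (hN_unit (e.symm w)) (hNW he hw).1
      (h_oriented e he w hw) (hNW he hw).2
    let T : ℂ ≃ₗ[ℝ] TangentSpace 𝓘(ℝ, ℂ) (e.symm w) := (coordEquiv he hw).toLinearEquiv
    refine ⟨T.toLinearMap ∘ₗ B ∘ₗ T.symm.toLinearMap, fun v ↦ ?_, ?_⟩
    · obtain ⟨u, rfl⟩ := T.surjective v
      have h1 : (T.toLinearMap ∘ₗ B ∘ₗ T.symm.toLinearMap) (T u) = coordVec e w (B u) := by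
        simp only [LinearMap.comp_apply, LinearEquiv.coe_coe, LinearEquiv.symm_apply_apply]
        rfl
      have h2 : T u = coordVec e w u := rfl
      rw [h1, h2, (hφ _).mfderiv_coordVec he hw, (hφ _).covAlong_coordVec hM hcov hE hN he hw,
        ← Finset.sum_neg_distrib]
      simp only [hB, mul_neg, neg_smul]
    · rw [LinearMap.det_conj, hdet, Real.sq_sqrt (hK_pos _).le]

end PrescribedImmersion

/-! ### Existence and uniqueness of the immersion. -/

theorem theorem3p1
    {M : Type*} [TopologicalSpace M] [T2Space M] [ChartedSpace (EuclideanSpace ℝ (Fin 3)) M]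
    [Group M] [LieGroup (𝓡 3) ∞ M]
    [RiemannianBundle (fun x : M ↦ TangentSpace (𝓡 3) x)]
    [IsContMDiffRiemannianBundle (𝓡 3) ∞ (EuclideanSpace ℝ (Fin 3))
      (fun x : M ↦ TangentSpace (𝓡 3) x)]
    (hM : IsLeftInvariantMetric M)
    (cov : CovariantDerivative (𝓡 3) (EuclideanSpace ℝ (Fin 3))
      (fun x : M ↦ TangentSpace (𝓡 3) x))
    (hcov : IsLeviCivita cov)
    (E : Fin 3 → GroupLieAlgebra (𝓡 3) M) (hE : IsOrthonormalFrame E)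
    {S : Type*} [TopologicalSpace S] [T2Space S] [SimplyConnectedSpace S]
    [ChartedSpace ℂ S] [IsManifold 𝓘(ℂ) ω S]
    (N : S → Fin 3 → ℝ) (hN : ContMDiff 𝓘(ℝ, ℂ) 𝓘(ℝ, Fin 3 → ℝ) ∞ N)
    (hN_unit : ∀ p, N p ⬝ᵥ N p = 1)
    (K : S → ℝ) (hK : ContMDiff 𝓘(ℝ, ℂ) 𝓘(ℝ, ℝ) ∞ K) (hK_pos : ∀ p, 0 < K p)
    (a : FormTriple S) (ha : a.IsSmooth)
    (h_system : SolvesLinearSystem (christoffel cov E) N K a)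
    (h_integrability : IntegrabilityCondition (christoffel cov E) N K a)
    (h_oriented : IsPositivelyOriented N a) :
    ∃ φ : S → M, IsPrescribedImmersion cov E φ N K a ∧
      ∀ ψ : S → M, IsPrescribedImmersion cov E ψ N K a ↔ ∃ m : M, ψ = fun p ↦ m * φ p := by
  have hskew := hcov.christoffel_skew hE
  obtain ⟨φ, hφ⟩ := exists_hasLeftDerivAt_of_local (E := E) (a := a) fun x : S ↦ by
    set e := chartAt ℂ x with he_def
    have he : e ∈ conformalCharts S := IsManifold.chart_mem_maximalAtlas x
    have hnd (k : Fin 3) : DifferentiableOn ℝ (fun y ↦ N (e.symm y) k) e.target :=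
      ((contMDiff_component hN k).contDiffOn_comp_symm he).differentiableOn (by simp)
    obtain ⟨g, hg⟩ := exists_local_solution hM hcov hE (A := a.coeff e) e.open_target (ha e he)
      (fun w hw l ↦ by
        obtain ⟨c, hc⟩ := h_integrability e he w hw
        exact im_covariant_conj_eq_zero (n := fun y ↦ N (e.symm y)) (κ := fun y ↦ K (e.symm y))
          (W := covZ (christoffel cov E) N a e) (U := covZBar (christoffel cov E) N a e) hskew
          e.open_target hnd (fun k ↦ (ha e he k).differentiableOn (by simp))
          (fun x _ ↦ hN_unit _) (fun x _ ↦ hK_pos _) (fun _ _ _ ↦ rfl) (fun _ _ _ ↦ rfl)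
          (h_system e he) hw hc l)
      (e.map_source (mem_chart_source ℂ x))
    exact ⟨_, exists_eventually_hasLeftDerivAt hg⟩
  have hmk {ψ : S → M} (hψ : ∀ p, HasLeftDerivAt E a ψ p) : IsPrescribedImmersion cov E ψ N K a :=
    isPrescribedImmersion_of_hasLeftDerivAt hM hcov hE hN hN_unit hK_pos h_system h_oriented hψ
  refine ⟨φ, hmk hφ, fun ψ ↦ ⟨fun hψ ↦ ?_, ?_⟩⟩
  -- Uniqueness needs only the equation for `ψ_z` and the smoothness of `ψ`.
  · exact exists_eq_mul_left hφ (hψ.derivative.hasLeftDerivAt hE hψ.immersion.contMDiff)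
  · rintro ⟨m, rfl⟩
    exact hmk fun p ↦ (hφ p).mul_left m
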